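/- Let $\mathbb{H}=\{\tau\in\mathbb{C}:\operatorname{Im}\tau>0\}$, let $q=e^{2\pi i\tau}$, and let $$\Delta(\tau)=q\prod_{n=1}^{\infty}(1-q^n)^{24},\qquad E_4(\tau)=1+240\sum_{n=1}^{\infty}\Big(\sum_{d\mid n}d^3\Big)q^n,\qquad j=\frac{E_4^3}{\Delta}=\frac1q+744+\cdots$$ be the modular discriminant, the normalized Eisenstein series of weight $4$ and the $j$-invariant. Let $g_\infty\colon\mathbb{H}\to\mathbb{R}$ be the hyperbolic Green function $$g_\infty(\tau)=-\log\big((4\pi\operatorname{Im}\tau)^6\,|\Delta(\tau)|\big).$$ There is a unique function $g_{\mathrm{hyp}}\colon\mathbb{C}\to\mathbb{R}$ such that $g_\infty=g_{\mathrm{hyp}}\circ j$. Writing $\zeta=x+iy$, the partial derivative $\partial_x g_{\mathrm{hyp}}(1)$ exists and satisfies $0<\partial_x g_{\mathrm{hyp}}(1)<1$, and the function $g_1\colon\mathbb{C}\setminus\{0\}\to\mathbb{R}$ defined by $$g_1(\zeta)=g_{\mathrm{hyp}}(\zeta)-\partial_x g_{\mathrm{hyp}}(1)\cdot\log|\zeta|$$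 attains its minimum value at, and only at, $\zeta=1$. -/

import Mathlib

open scoped UpperHalfPlane

noncomputable section

/-- The `j`-invariant `j = E₄³ / Δ` on the upper half-plane, so that `j = 1/q + 744 + ⋯` with
`q = exp (2πiτ)`.  Here `E₄` has constant term `1`, and
`Δ = q ∏ (1 - qⁿ) ^ 24` (this product formula is `ModularForm.discriminant_eq_q_prod`). -/
def jInv (τ : ℍ) : ℂ := ModularForm.E₄ τ ^ 3 / ModularForm.discriminant τ

/-- The hyperbolic Green function `g_∞(τ) = -log ((4π Im τ)⁶ |Δ(τ)|)`. -/
def gInfty (τ : ℍ) : ℝ :=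
  -Real.log ((4 * Real.pi * τ.im) ^ 6 * ‖ModularForm.discriminant τ‖)

/-- `g₁(ζ) = g(ζ) - ∂ₓg(1) · log |ζ|`, where `∂ₓg(1)` is the derivative of `g` at the point `1`
in the real direction. -/
def gOne (g : ℂ → ℝ) (ζ : ℂ) : ℝ := g ζ - lineDeriv ℝ g 1 1 * Real.log ‖ζ‖

end

open scoped UpperHalfPlane MatrixGroups Manifold Topology ComplexConjugate
open UpperHalfPlane ModularForm Filter

/-! Since `j` is onto and separates `SL(2, ℤ)`-orbits, the invariant function `gInfty` descends to
the plane. Writing `κ` for the derivative at `1`, `g₁ ∘ j` is `-6 log(4πy) - (1 - κ) log|Δ| - 3κ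
log|E₄|`. The point where `j = 1` lies very close to the zero `ρ` of `j`, so the minimum is decided
there.

Let `w` be the Cayley coordinate centred at `ρ`. The stabilizer of `ρ` acts by rotations of order
three, so, once automorphy factors are removed, `Δ` and `E₄ / w` are holomorphic in `s = w³`. With
`D = deltaLog` and `E = eLog`, the logarithms vanishing at `0`, one has `j = jScale · s · exp(3E -
D)` near `0`, and `g₁ ∘ j` is, up to a constant, `-6 log(1 - |w|²) - 3κ log|w| - Re((1 - κ) D(s) +
3κ E(s))`.

The Taylor coefficients of `D` and `E` are real, the first one of `D` lies in `[14, 21.5]`, and `κ ≤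
0.00125` makes `E` harmless. Hence, for `|w| ≤ 0.13`, the minimum on each circle is at `s = |s|`
(`angular_defect_nonneg`). Along the positive axis the quadratic term of the slope dominates the
cubic ones, so the slope has a single sign change (`radialSlope_lt`); it occurs at the radius where
`j = 1`, because `κ` is the derivative there. The rest of the fundamental domain has `Im τ ≥ 0.957`,
where `q`-series bounds suffice (`gOne_one_lt_of_le_im`).

The coefficient bounds come from near-maximality of `y⁶|Δ|` at `ρ` with Borel–Carathéodory for `D`,
and from the Schwarz lemma for `E`. -/

/-! ### Modularity, behaviour at the cusp and surjectivity of `j`. -/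

theorem discriminant_smul (γ : SL(2, ℤ)) (τ : ℍ) :
    discriminant (γ • τ) = denom γ τ ^ 12 * discriminant τ := by
  have h := SlashInvariantForm.slash_action_eqn'' CuspForm.discriminant (γ := (γ : GL (Fin 2) ℝ))
    (MonoidHom.mem_range.mpr ⟨γ, rfl⟩) τ
  simpa using h

theorem E₄_smul (γ : SL(2, ℤ)) (τ : ℍ) : E₄ (γ • τ) = denom γ τ ^ 4 * E₄ τ := by
  have h := SlashInvariantForm.slash_action_eqn'' E₄ (γ := (γ : GL (Fin 2) ℝ))
    (MonoidHom.mem_range.mpr ⟨γ, rfl⟩) τ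
  simpa using h

theorem jInv_smul (γ : SL(2, ℤ)) (τ : ℍ) : jInv (γ • τ) = jInv τ := by
  have := denom_ne_zero γ τ
  have := discriminant_ne_zero τ
  rw [jInv, jInv, discriminant_smul, E₄_smul]
  field_simp

theorem gInfty_smul (γ : SL(2, ℤ)) (τ : ℍ) : gInfty (γ • τ) = gInfty τ := by
  have h1 := denom_ne_zero γ τ
  rw [gInfty, gInfty, discriminant_smul, ModularGroup.im_smul_eq_div_normSq, norm_mul, norm_pow,
    Complex.normSq_eq_norm_sq]
  have : ‖denom γ τ‖ ≠ 0 := norm_ne_zero_iff.mpr h1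
  congr 2
  field_simp

theorem differentiableOn_discriminant :
    DifferentiableOn ℂ (fun z => discriminant (ofComplex z)) {z | 0 < z.im} :=
  mdifferentiable_iff.mp CuspForm.discriminant.holo'

theorem differentiableOn_E₄ :
    DifferentiableOn ℂ (fun z => E₄ (ofComplex z)) {z | 0 < z.im} :=
  mdifferentiable_iff.mp E₄.holo'

theorem differentiableOn_jInv : DifferentiableOn ℂ (fun z => jInv (ofComplex z)) {z | 0 < z.im} :=
  (differentiableOn_E₄.pow 3).div differentiableOn_discriminant fun _ _ => discriminant_ne_zero _

theorem E₄_tendsto : Tendsto E₄ atImInfty (𝓝 1) := by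
  have h0 := qExpansion_coeff_zero one_pos (ModularFormClass.analyticAt_cuspFunction_zero E₄ one_pos
    one_mem_strictPeriods_SL) (SlashInvariantFormClass.periodic_comp_ofComplex E₄
    one_mem_strictPeriods_SL)
  have h1 := (ModularFormClass.analyticAt_cuspFunction_zero E₄ one_pos
    one_mem_strictPeriods_SL).continuousAt.tendsto.comp (qParam_tendsto_atImInfty one_pos)
  have h2 : cuspFunction 1 E₄ 0 = 1 := by
    have := EisensteinSeries.E_qExpansion_coeff_zero (k := 4) (by norm_num) ⟨2, rfl⟩
    rw [qExpansion_coeff] at this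
    simpa using this
  rw [h2] at h1
  refine h1.congr fun τ => ?_
  exact SlashInvariantFormClass.eq_cuspFunction E₄ τ one_mem_strictPeriods_SL one_ne_zero

theorem discriminant_div_E₄_tendsto :
    Tendsto (fun τ => discriminant τ / E₄ τ ^ 3) atImInfty (𝓝 0) := by
  have h : Tendsto discriminant atImInfty (𝓝 0) := discriminant_isZeroAtImInfty
  simpa [Pi.div_def] using h.div (E₄_tendsto.pow 3) (by norm_num)

theorem tendsto_norm_jInv_atImInfty : Tendsto (fun τ => ‖jInv τ‖) atImInfty atTop := by
  have h : Tendsto (fun τ => discriminant τ / E₄ τ ^ 3) atImInfty (𝓝[≠] 0) := by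
    refine tendsto_nhdsWithin_iff.mpr ⟨discriminant_div_E₄_tendsto, ?_⟩
    filter_upwards [E₄_tendsto.eventually_ne one_ne_zero] with τ hτ
    exact div_ne_zero (discriminant_ne_zero τ) (pow_ne_zero 3 hτ)
  refine (tendsto_norm_inv_nhdsNE_zero_atTop.comp h).congr fun τ => ?_
  simp [jInv]

/-- The `j`-invariant takes every complex value. -/
theorem jInv_surjective : Function.Surjective jInv := by
  intro c
  by_contra hc
  push Not at hc
  -- If `c` is omitted, `Δ / (E₄³ - cΔ)` is a modular form of weight `0` vanishing at the cusp. It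
  -- is then constant, hence zero, although `Δ` has no zeros.
  have hne : ∀ τ, E₄ τ ^ 3 - c * discriminant τ ≠ 0 := fun τ h => hc τ <| by
    rw [jInv, div_eq_iff (discriminant_ne_zero τ), sub_eq_zero.mp h]
  have hlim : Tendsto (fun τ => discriminant τ / (E₄ τ ^ 3 - c * discriminant τ)) atImInfty
      (𝓝 0) := by
    have h : Tendsto discriminant atImInfty (𝓝 0) := discriminant_isZeroAtImInfty
    simpa [Pi.div_def] using h.div ((E₄_tendsto.pow 3).sub (h.const_mul c)) (by norm_num)
  have hslash : ∀ γ : SL(2, ℤ), (fun τ => discriminant τ / (E₄ τ ^ 3 - c * discriminant τ))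
      ∣[(0 : ℤ)] γ = fun τ => discriminant τ / (E₄ τ ^ 3 - c * discriminant τ) := by
    intro γ
    ext τ
    rw [ModularForm.SL_slash_apply, discriminant_smul, E₄_smul,
      show (denom γ τ ^ 4 * E₄ τ) ^ 3 - c * (denom γ τ ^ 12 * discriminant τ)
        = denom γ τ ^ 12 * (E₄ τ ^ 3 - c * discriminant τ) by ring,
      mul_div_mul_left _ _ (pow_ne_zero 12 (denom_ne_zero γ τ))]
    simp
  let f : ModularForm 𝒮ℒ 0 :=
    { toFun := fun τ => discriminant τ / (E₄ τ ^ 3 - c * discriminant τ)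
      slash_action_eq' := by
        rintro _ ⟨γ, rfl⟩
        exact hslash γ
      holo' := mdifferentiable_iff.mpr <| differentiableOn_discriminant.div
        ((differentiableOn_E₄.pow 3).sub (differentiableOn_discriminant.const_mul c))
        fun _ _ => hne _
      bdd_at_cusps' := by
        intro x hx
        rw [Subgroup.IsArithmetic.isCusp_iff_isCusp_SL2Z] at hx
        rw [OnePoint.isBoundedAt_iff_forall_SL2Z hx]
        intro γ _
        rw [hslash γ]
        exact hlim.isBigO_one ℝ }
  obtain ⟨d, hd⟩ := ModularFormClass.levelOne_weight_zero_const f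
  have h1 : ∀ τ, discriminant τ / (E₄ τ ^ 3 - c * discriminant τ) = d := fun τ => congrFun hd τ
  simp only [h1] at hlim
  have h2 := tendsto_nhds_unique hlim tendsto_const_nhds
  have := h1 I
  rw [← h2] at this
  exact div_ne_zero (discriminant_ne_zero _) (hne _) this

/-! ### Injectivity of `j` on orbits, and descent of `gInfty`. -/

theorem HasStrictDerivAt.exists_injOn {f : ℂ → ℂ} {f' a : ℂ} (hf : HasStrictDerivAt f f' a)
    (hf' : f' ≠ 0) : ∃ U ∈ 𝓝 a, Set.InjOn f U :=
  ⟨_, hf.eventually_left_inverse hf', fun _ hx _ hy h => by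
    rw [← Set.mem_ofPred.mp hx, ← Set.mem_ofPred.mp hy, h]⟩

/-- As a function of `q`, `1/j = Δ/E₄³` has derivative `1` at `q = 0`, so it is injective near `0`;
two points with the same `q` differ by an integer translation. -/
theorem jInv_injective_of_large_im :
    ∃ Y : ℝ, ∀ τ₁ τ₂ : ℍ, Y < τ₁.im → Y < τ₂.im → jInv τ₁ = jInv τ₂ →
      ∃ γ : SL(2, ℤ), γ • τ₁ = τ₂ := by
  have hE := ModularFormClass.analyticAt_cuspFunction_zero E₄ one_pos one_mem_strictPeriods_SL
  have hD := ModularFormClass.analyticAt_cuspFunction_zero CuspForm.discriminant one_pos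
    one_mem_strictPeriods_SL
  have hE0 : cuspFunction 1 E₄ 0 = 1 := by
    have := EisensteinSeries.E_qExpansion_coeff_zero (k := 4) (by norm_num) ⟨2, rfl⟩
    rw [qExpansion_coeff] at this
    simpa using this
  have hD0 : cuspFunction 1 CuspForm.discriminant 0 = 0 :=
    CuspFormClass.cuspFunction_apply_zero _ one_pos one_mem_strictPeriods_SL
  have hD1 : deriv (cuspFunction 1 CuspForm.discriminant) 0 = 1 := by
    have := discriminant_qExpansion_coeff_one
    rw [qExpansion_coeff] at this
    simpa using this
  have hQ : HasStrictDerivAt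
      (fun q => cuspFunction 1 CuspForm.discriminant q / cuspFunction 1 E₄ q ^ 3) 1 0 := by
    have h := (hD.div (hE.pow 3) (by simp [hE0])).hasStrictDerivAt
    have h2 := (hD.hasStrictDerivAt.hasDerivAt.div (hE.hasStrictDerivAt.hasDerivAt.pow 3)
      (by simp [hE0])).deriv
    simp only [Pi.pow_apply, hD0, hE0, hD1] at h2
    rw [h2] at h
    simpa [Pi.div_def] using h
  obtain ⟨U, hU, hinj⟩ := hQ.exists_injOn one_ne_zero
  have hq := (qParam_tendsto_atImInfty one_pos).eventually hU
  obtain ⟨Y, hY⟩ := (atImInfty_mem _).mp hq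
  refine ⟨Y, fun τ₁ τ₂ h1 h2 hj => ?_⟩
  have key : ∀ τ : ℍ, cuspFunction 1 CuspForm.discriminant (Function.Periodic.qParam 1 τ) /
      cuspFunction 1 E₄ (Function.Periodic.qParam 1 τ) ^ 3 = (jInv τ)⁻¹ := by
    intro τ
    rw [SlashInvariantFormClass.eq_cuspFunction E₄ τ one_mem_strictPeriods_SL one_ne_zero,
      SlashInvariantFormClass.eq_cuspFunction CuspForm.discriminant τ one_mem_strictPeriods_SL
      one_ne_zero, jInv, inv_div]
    rfl
  have h3 := hinj (hY τ₁ h1.le) (hY τ₂ h2.le) (by simp only [key, hj])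
  rw [Function.Periodic.qParam, Function.Periodic.qParam, Complex.exp_eq_exp_iff_exists_int] at h3
  obtain ⟨n, hn⟩ := h3
  refine ⟨ModularGroup.T ^ (-n), UpperHalfPlane.ext ?_⟩
  rw [ModularGroup.coe_T_zpow_smul_eq]
  have : (2 * Real.pi * Complex.I : ℂ) ≠ 0 := Complex.two_pi_I_ne_zero
  field_simp at hn
  push_cast at hn ⊢
  rw [hn]; ring

/-- By the identity theorem the zeros of `j'` are isolated, since `j` is not constant. -/
theorem countable_jInv_critical :
    {z : ℂ | 0 < z.im ∧ deriv (fun z => jInv (ofComplex z)) z = 0}.Countable := by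
  set J := fun z => jInv (ofComplex z)
  have hA : AnalyticOnNhd ℂ (deriv J) {z | 0 < z.im} :=
    (differentiableOn_jInv.analyticOnNhd isOpen_upperHalfPlaneSet).deriv
  have hpre : IsPreconnected {z : ℂ | 0 < z.im} := (convex_halfSpace_im_gt 0).isPreconnected
  have hdisc : DiscreteTopology {z : ℂ | 0 < z.im ∧ deriv J z = 0} := by
    rw [discreteTopology_subtype_iff]
    rintro z ⟨hz, -⟩
    rw [← Filter.empty_mem_iff_bot, Filter.mem_inf_principal]
    by_contra hcon
    have hfr : ∃ᶠ x in 𝓝[≠] z, deriv J x = 0 := fun h => hcon <| by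
      filter_upwards [h] with x hx hx'
      exact hx hx'.2
    have h0 := hA.eqOn_zero_of_preconnected_of_frequently_eq_zero hpre hz hfr
    obtain ⟨a, ha⟩ := jInv_surjective 0
    obtain ⟨b, hb⟩ := jInv_surjective 1
    have := isOpen_upperHalfPlaneSet.is_const_of_deriv_eq_zero hpre differentiableOn_jInv h0
      a.im_pos b.im_pos
    simp [ha, hb] at this
  exact Set.countable_coe_iff.mp (countable_of_Lindelof_of_discrete)

theorem continuous_jInv : Continuous jInv := by
  have h := differentiableOn_jInv.continuousOn.comp_continuous continuous_coe fun τ => τ.im_pos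
  simpa [Function.comp_def] using h

theorem isOpenMap_jInv : IsOpenMap jInv := by
  have hpre : IsPreconnected {z : ℂ | 0 < z.im} := (convex_halfSpace_im_gt 0).isPreconnected
  intro U hU
  rcases (differentiableOn_jInv.analyticOnNhd isOpen_upperHalfPlaneSet).is_constant_or_isOpen hpre
    with ⟨w, hw⟩ | h
  · obtain ⟨τ, hτ⟩ := jInv_surjective (w + 1)
    have := hw τ τ.im_pos
    simp [hτ] at this
  · have h2 := h (UpperHalfPlane.coe '' U) (by rintro _ ⟨τ, -, rfl⟩; exact τ.im_pos)
      (isOpenEmbedding_coe.isOpenMap U hU)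
    rw [Set.image_image] at h2
    simpa using h2

theorem exists_injOn_jInv {τ : ℍ} (h : deriv (fun z => jInv (ofComplex z)) τ ≠ 0) :
    ∃ U ∈ 𝓝 τ, Set.InjOn jInv U := by
  obtain ⟨U, hU, hinj⟩ := ((differentiableOn_jInv.analyticOnNhd isOpen_upperHalfPlaneSet)
    τ τ.im_pos).hasStrictDerivAt.exists_injOn h
  refine ⟨UpperHalfPlane.coe ⁻¹' U, continuous_coe.continuousAt.preimage_mem_nhds hU, ?_⟩
  intro x hx y hy hxy
  exact UpperHalfPlane.ext (hinj hx hy (by simpa using hxy))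

/-- Values of `j` attained at two inequivalent points. -/
def jInvMultipleValues : Set ℂ :=
  {c | ∃ τ₁ τ₂, jInv τ₁ = c ∧ jInv τ₂ = c ∧ ∀ γ : SL(2, ℤ), γ • τ₁ ≠ τ₂}

theorem exists_mem_fd_of_mem_jInvMultipleValues {c : ℂ} (hc : c ∈ jInvMultipleValues) :
    ∃ τ₁ ∈ ModularGroup.fd, ∃ τ₂ ∈ ModularGroup.fd, jInv τ₁ = c ∧ jInv τ₂ = c ∧
      ∀ γ : SL(2, ℤ), γ • τ₁ ≠ τ₂ := by
  obtain ⟨τ₁, τ₂, h1, h2, h⟩ := hc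
  obtain ⟨γ₁, hγ₁⟩ := ModularGroup.exists_smul_mem_fd τ₁
  obtain ⟨γ₂, hγ₂⟩ := ModularGroup.exists_smul_mem_fd τ₂
  refine ⟨_, hγ₁, _, hγ₂, by rw [jInv_smul, h1], by rw [jInv_smul, h2], fun γ hγ => ?_⟩
  refine h (γ₂⁻¹ * (γ * γ₁)) ?_
  rw [mul_smul, mul_smul, hγ, inv_smul_smul]

/-- The orbit space is Hausdorff and `j` is open: the images of two saturated neighbourhoods,
disjoint modulo the group, both cover a neighbourhood of `c`. -/
theorem isOpen_jInvMultipleValues : IsOpen jInvMultipleValues := by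
  rw [isOpen_iff_mem_nhds]
  rintro c ⟨τ₁, τ₂, h1, h2, h⟩
  let p : ℍ → Quotient (MulAction.orbitRel 𝒮ℒ ℍ) := Quotient.mk _
  have hp : Continuous p := continuous_quotient_mk'
  have heq : ∀ x y : ℍ, p x = p y ↔ ∃ γ : SL(2, ℤ), γ • x = y := by
    intro x y
    rw [Quotient.eq, MulAction.orbitRel_apply, ← MulAction.mem_orbit_symm]
    constructor
    · rintro ⟨⟨_, ⟨γ, rfl⟩⟩, hg⟩
      exact ⟨γ, hg⟩
    · rintro ⟨γ, hγ⟩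
      exact ⟨⟨_, ⟨γ, rfl⟩⟩, hγ⟩
  have hne : p τ₁ ≠ p τ₂ := fun e => by
    obtain ⟨γ, hγ⟩ := (heq _ _).mp e
    exact h γ hγ
  obtain ⟨U, V, hU, hV, h1U, h2V, hUV⟩ := t2_separation hne
  filter_upwards [(isOpenMap_jInv _ (hU.preimage hp)).mem_nhds ⟨τ₁, h1U, h1⟩,
    (isOpenMap_jInv _ (hV.preimage hp)).mem_nhds ⟨τ₂, h2V, h2⟩]
  rintro _ ⟨x, hx, rfl⟩ ⟨y, hy, hxy⟩
  refine ⟨x, y, rfl, hxy, fun γ hγ => ?_⟩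
  have h3 : p x = p y := (heq _ _).mpr ⟨γ, hγ⟩
  have hx' : p x ∈ U := hx
  have hy' : p y ∈ V := hy
  exact hUV.ne_of_mem hx' hy' h3

/-- A value larger than `|j|` on the truncated fundamental domain is only attained high in the cusp,
where `j` separates orbits. -/
theorem exists_norm_le_of_mem_jInvMultipleValues :
    ∃ M : ℝ, ∀ c ∈ jInvMultipleValues, ‖c‖ ≤ M := by
  obtain ⟨Y, hY⟩ := jInv_injective_of_large_im
  obtain ⟨M, hM⟩ := (((ModularGroup.isCompact_truncatedFundamentalDomain Y).image
    continuous_jInv).isBounded).exists_norm_le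
  refine ⟨M, fun c hc => ?_⟩
  obtain ⟨τ₁, hf1, τ₂, hf2, h1, h2, h⟩ := exists_mem_fd_of_mem_jInvMultipleValues hc
  by_contra! hlt
  have him : ∀ τ ∈ ModularGroup.fd, jInv τ = c → Y < τ.im := by
    intro τ hτ hj
    by_contra! hle
    have := hM _ ⟨τ, ⟨hτ, hle⟩, rfl⟩
    rw [hj] at this
    linarith
  obtain ⟨γ, hγ⟩ := hY _ _ (him _ hf1 h1) (him _ hf2 h2) (h1.trans h2.symm)
  exact h γ hγ

/-- Inequivalent pairs in the fundamental domain stay in a compact set, so a subsequence converges.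
If the limits were equivalent, moving one by `γ⁻¹` would give two inequivalent points with the same
value arbitrarily near one noncritical point, against local injectivity. -/
theorem mem_jInvMultipleValues_of_mem_closure {c : ℂ} (hc : c ∈ closure jInvMultipleValues)
    (hcrit : ∀ τ : ℍ, jInv τ = c → deriv (fun z => jInv (ofComplex z)) τ ≠ 0) :
    c ∈ jInvMultipleValues := by
  obtain ⟨u, hu, hlim⟩ := mem_closure_iff_seq_limit.mp hc
  choose x hx y hy hjx hjy hne using fun n => exists_mem_fd_of_mem_jInvMultipleValues (hu n)
  obtain ⟨R, hR⟩ := (Metric.isBounded_range_of_tendsto _ hlim).exists_norm_le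
  obtain ⟨Y, hY⟩ := (atImInfty_mem _).mp (tendsto_norm_jInv_atImInfty.eventually_gt_atTop R)
  have hK := ModularGroup.isCompact_truncatedFundamentalDomain Y
  have htr : ∀ n τ, τ ∈ ModularGroup.fd → jInv τ = u n →
      τ ∈ ModularGroup.truncatedFundamentalDomain Y := by
    refine fun n τ hτ hj => ⟨hτ, ?_⟩
    by_contra! hlt
    have h1 : R < ‖jInv τ‖ := hY τ hlt.le
    have h2 := hR _ ⟨n, rfl⟩
    rw [hj] at h1
    linarith
  obtain ⟨⟨a, b⟩, -, φ, hφ, hab⟩ := (hK.prod hK).tendsto_subseq (x := fun n => (x n, y n))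
    fun n => ⟨htr n _ (hx n) (hjx n), htr n _ (hy n) (hjy n)⟩
  rw [nhds_prod_eq, tendsto_prod_iff'] at hab
  obtain ⟨ha, hb⟩ := hab
  have hlim' := hlim.comp hφ.tendsto_atTop
  have hja : jInv a = c := tendsto_nhds_unique (continuous_jInv.continuousAt.tendsto.comp ha)
    (hlim'.congr fun n => (hjx _).symm)
  have hjb : jInv b = c := tendsto_nhds_unique (continuous_jInv.continuousAt.tendsto.comp hb)
    (hlim'.congr fun n => (hjy _).symm)
  by_cases hγ : ∀ γ : SL(2, ℤ), γ • a ≠ b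
  · exact ⟨a, b, hja, hjb, hγ⟩
  push Not at hγ
  obtain ⟨γ, rfl⟩ := hγ
  obtain ⟨U, hU, hinj⟩ := exists_injOn_jInv (hcrit a hja)
  have hb' : Tendsto (fun n => γ⁻¹ • y (φ n)) atTop (𝓝 a) := by
    have hc : Continuous fun τ : ℍ => γ⁻¹ • τ := continuous_const_smul ((γ⁻¹ : SL(2, ℤ)) : GL (Fin 2) ℝ)
    have h := (hc.tendsto (γ • a)).comp hb
    rwa [inv_smul_smul] at h
  obtain ⟨n, hn1, hn2⟩ := ((ha.eventually hU).and (hb'.eventually hU)).exists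
  have := hinj hn1 hn2 (by simp only [Function.comp_apply, jInv_smul]; rw [hjx, hjy])
  exact absurd (eq_inv_smul_iff.mp this) (hne _ γ)

/-- Off the countable set `B` of critical values, the multiple values are open and closed. As `Bᶜ`
is connected and dense, one multiple value would make all of `Bᶜ` multiple, against boundedness. -/
theorem jInvMultipleValues_eq_empty : jInvMultipleValues = ∅ := by
  by_contra hne
  obtain ⟨c, hc⟩ := Set.nonempty_iff_ne_empty.mpr hne
  set B := (fun z => jInv (ofComplex z)) ''
    {z : ℂ | 0 < z.im ∧ deriv (fun z => jInv (ofComplex z)) z = 0} with hB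
  have hBc : B.Countable := countable_jInv_critical.image _
  have hconn : IsPreconnected Bᶜ := (hBc.isPathConnected_compl_of_one_lt_rank
    (by rw [Complex.rank_real_complex]; norm_num)).isConnected.isPreconnected
  have hdense : Dense Bᶜ := hBc.dense_compl ℝ
  have hsub : Bᶜ ⊆ jInvMultipleValues := by
    refine hconn.subset_of_closure_inter_subset isOpen_jInvMultipleValues ?_ ?_
    · obtain ⟨z, hz1, hz2⟩ := hdense.inter_open_nonempty _ isOpen_jInvMultipleValues ⟨c, hc⟩
      exact ⟨z, hz2, hz1⟩
    · rintro z ⟨hz, hzB⟩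
      refine mem_jInvMultipleValues_of_mem_closure hz fun τ hτ h => hzB ⟨τ, ⟨τ.im_pos, h⟩, ?_⟩
      simpa using hτ
  obtain ⟨M, hM⟩ := exists_norm_le_of_mem_jInvMultipleValues
  obtain ⟨z, hz1, hz2⟩ := hdense.inter_open_nonempty {z : ℂ | M < ‖z‖}
    (isOpen_lt continuous_const continuous_norm)
    ⟨((|M| + 1 : ℝ) : ℂ), by
      simp only [Set.mem_ofPred_eq, Complex.norm_real, Real.norm_eq_abs]
      rw [abs_of_pos (by positivity)]
      linarith [le_abs_self M]⟩
  exact absurd (hM z (hsub hz2)) (not_le.mpr hz1)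

/-- The `j`-invariant separates `SL(2, ℤ)`-orbits. -/
theorem exists_smul_eq_of_jInv_eq {τ₁ τ₂ : ℍ} (h : jInv τ₁ = jInv τ₂) :
    ∃ γ : SL(2, ℤ), γ • τ₁ = τ₂ := by
  by_contra! hne
  have : jInv τ₂ ∈ jInvMultipleValues := ⟨τ₁, τ₂, h, rfl, hne⟩
  rw [jInvMultipleValues_eq_empty] at this
  exact this

theorem gInfty_eq_of_jInv_eq {τ₁ τ₂ : ℍ} (h : jInv τ₁ = jInv τ₂) : gInfty τ₁ = gInfty τ₂ := by
  obtain ⟨γ, rfl⟩ := exists_smul_eq_of_jInv_eq h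
  rw [gInfty_smul]

theorem existsUnique_gInfty_eq_comp_jInv : ∃! g : ℂ → ℝ, gInfty = g ∘ jInv := by
  refine ⟨fun c => gInfty (Function.surjInv jInv_surjective c), ?_, fun g hg => ?_⟩
  · funext τ
    exact gInfty_eq_of_jInv_eq (Function.surjInv_eq jInv_surjective (jInv τ)).symm
  · funext c
    rw [hg, Function.comp_apply, Function.surjInv_eq jInv_surjective c]

/-! ### Functions of the cube, and holomorphic logarithms. -/

theorem cube_eq_cube_cases {ω v w : ℂ} (hω : ω ^ 2 + ω + 1 = 0) (h : v ^ 3 = w ^ 3) :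
    v = w ∨ v = ω * w ∨ v = ω * (ω * w) := by
  have : (v - w) * ((v - ω * w) * (v - ω * (ω * w))) = 0 := by
    linear_combination h + (-v ^ 2 * w + v * w ^ 2 * ω - w ^ 3 * (ω - 1)) * hω
  rcases mul_eq_zero.mp this with h | h
  · exact Or.inl (sub_eq_zero.mp h)
  · rcases mul_eq_zero.mp h with h | h
    · exact Or.inr (Or.inl (sub_eq_zero.mp h))
    · exact Or.inr (Or.inr (sub_eq_zero.mp h))

theorem norm_eq_one_of_sq_add_self_add_one {ω : ℂ} (hω : ω ^ 2 + ω + 1 = 0) : ‖ω‖ = 1 := by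
  have h3 : ω ^ 3 = 1 := by linear_combination (ω - 1) * hω
  exact Complex.norm_eq_one_of_pow_eq_one h3 (by norm_num)

theorem cpow_third_pow (s : ℂ) : (s ^ (1 / 3 : ℂ)) ^ 3 = s := by
  rw [← Complex.cpow_nat_mul]; norm_num

theorem norm_lt_one_of_pow_three {s v : ℂ} (h : v ^ 3 = s) (hs : ‖s‖ < 1) : ‖v‖ < 1 := by
  rw [← h, norm_pow] at hs
  exact (pow_lt_one_iff_of_nonneg (norm_nonneg v) (by norm_num)).mp hs

/-- A holomorphic function on the unit disc invariant under rotation by a cube root of unity is a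
holomorphic function of the cube of its argument. -/
theorem exists_eq_comp_cube {f : ℂ → ℂ} (hf : DifferentiableOn ℂ f (Metric.ball 0 1)) {ω : ℂ}
    (hω : ω ^ 2 + ω + 1 = 0) (hinv : ∀ w ∈ Metric.ball (0 : ℂ) 1, f (ω * w) = f w) :
    ∃ H : ℂ → ℂ, DifferentiableOn ℂ H (Metric.ball 0 1) ∧
      ∀ w ∈ Metric.ball (0 : ℂ) 1, H (w ^ 3) = f w := by
  have hω1 := norm_eq_one_of_sq_add_self_add_one hω
  -- The value does not depend on the chosen cube root, so any local branch may be used: the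
  -- principal one on the slit plane and `-(-t)^(1/3)` across the cut. The origin is a removable
  -- singularity.
  have key : ∀ w ∈ Metric.ball (0 : ℂ) 1, f ((w ^ 3) ^ (1 / 3 : ℂ)) = f w := by
    intro w hw
    have hw' : ω * w ∈ Metric.ball (0 : ℂ) 1 := by simpa [hω1] using hw
    rcases cube_eq_cube_cases hω (cpow_third_pow (w ^ 3)) with h | h | h
    · rw [h]
    · rw [h, hinv w hw]
    · rw [h, hinv _ hw', hinv w hw]
  have hd : ∀ w ∈ Metric.ball (0 : ℂ) 1, DifferentiableAt ℂ f w := fun w hw =>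
    hf.differentiableAt (Metric.isOpen_ball.mem_nhds hw)
  have hroot : ∀ s ∈ Metric.ball (0 : ℂ) 1, ∀ v : ℂ, v ^ 3 = s → v ∈ Metric.ball (0 : ℂ) 1 := by
    intro s hs v hv
    rw [mem_ball_zero_iff] at hs ⊢
    exact norm_lt_one_of_pow_three hv hs
  refine ⟨fun s => f (s ^ (1 / 3 : ℂ)), ?_, key⟩
  refine (Complex.differentiableOn_compl_singleton_and_continuousAt_iff (c := 0)
    (Metric.ball_mem_nhds 0 one_pos)).mp ⟨?_, ?_⟩
  · rintro s ⟨hs, hs0⟩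
    refine DifferentiableAt.differentiableWithinAt ?_
    by_cases hsl : s ∈ Complex.slitPlane
    · exact (hd _ (hroot s hs _ (cpow_third_pow s))).fun_comp' s
        (differentiableAt_id.cpow_const (c := (1 / 3 : ℂ)) hsl)
    · have hneg : -s ∈ Complex.slitPlane := by
        rw [Complex.mem_slitPlane_iff] at hsl ⊢
        push Not at hsl
        left
        have : s.re ≠ 0 := fun h => hs0 (Complex.ext h hsl.2)
        have := lt_of_le_of_ne hsl.1 this
        simpa using this
      have hcube : ∀ t : ℂ, (-((-t) ^ (1 / 3 : ℂ))) ^ 3 = t := fun t => by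
        linear_combination -cpow_third_pow (-t)
      have heq : (fun s => f (s ^ (1 / 3 : ℂ))) =ᶠ[𝓝 s] fun t => f (-((-t) ^ (1 / 3 : ℂ))) := by
        filter_upwards [Metric.isOpen_ball.mem_nhds hs] with t ht
        rw [← key _ (hroot t ht _ (hcube t)), hcube t]
      refine DifferentiableAt.congr_of_eventuallyEq ?_ heq
      exact (hd _ (hroot s hs _ (hcube s))).fun_comp' s
        (differentiableAt_id.neg.cpow_const (c := (1 / 3 : ℂ)) hneg).neg
  · have h0 : ((0 : ℂ) ^ (1 / 3 : ℂ)) = 0 := Complex.zero_cpow (by norm_num)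
    have hc : ContinuousAt (fun s : ℂ => s ^ (1 / 3 : ℂ)) 0 :=
      Complex.continuousAt_cpow_const_of_re_pos (by simp) (by norm_num)
    refine ContinuousAt.comp' (g := f) ?_ hc
    rw [h0]
    exact (hd 0 (Metric.mem_ball_self one_pos)).continuousAt

theorem eqOn_of_exp_eq {R : ℝ} {f g : ℂ → ℂ} (hf : DifferentiableOn ℂ f (Metric.ball 0 R))
    (hg : DifferentiableOn ℂ g (Metric.ball 0 R)) (h0 : f 0 = g 0)
    (h : ∀ z ∈ Metric.ball (0 : ℂ) R, Complex.exp (f z) = Complex.exp (g z)) :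
    Set.EqOn f g (Metric.ball 0 R) := by
  rcases le_or_gt R 0 with hR | hR
  · rw [Metric.ball_eq_empty.mpr hR]
    exact Set.eqOn_empty _ _
  refine Metric.isOpen_ball.eqOn_of_deriv_eq (convex_ball 0 R).isPreconnected hf hg ?_
    (Metric.mem_ball_self hR) h0
  intro z hz
  have hn := Metric.isOpen_ball.mem_nhds hz
  have h1 := (hf.differentiableAt hn).hasDerivAt.cexp
  have h2 := (hg.differentiableAt hn).hasDerivAt.cexp
  have heq : (fun x => Complex.exp (f x)) =ᶠ[𝓝 z] fun x => Complex.exp (g x) := by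
    filter_upwards [hn] with x hx using h x hx
  have h3 := h1.unique (h2.congr_of_eventuallyEq heq)
  rw [h z hz] at h3
  exact mul_left_cancel₀ (Complex.exp_ne_zero _) h3

theorem differentiableOn_conj_conj {R : ℝ} {f : ℂ → ℂ}
    (hf : DifferentiableOn ℂ f (Metric.ball 0 R)) :
    DifferentiableOn ℂ (fun z => conj (f (conj z))) (Metric.ball 0 R) := by
  intro z hz
  have hz' : conj z ∈ Metric.ball (0 : ℂ) R := by simpa using hz
  have := (hf.differentiableAt (Metric.isOpen_ball.mem_nhds hz')).hasDerivAt.conj_conj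
  simp only [Complex.conj_conj] at this
  exact this.differentiableAt.differentiableWithinAt

/-- A zero-free holomorphic function on a disc with value `1` at the centre has a holomorphic
logarithm, compatible with complex conjugation if the function is. -/
theorem exists_log_on_ball {R : ℝ} {f : ℂ → ℂ} (hR : 0 < R)
    (hf : DifferentiableOn ℂ f (Metric.ball 0 R))
    (h0 : f 0 = 1) (hne : ∀ z ∈ Metric.ball (0 : ℂ) R, f z ≠ 0)
    (hconj : ∀ z ∈ Metric.ball (0 : ℂ) R, f (conj z) = conj (f z)) :
    ∃ H : ℂ → ℂ, DifferentiableOn ℂ H (Metric.ball 0 R) ∧ H 0 = 0 ∧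
      (∀ z ∈ Metric.ball (0 : ℂ) R, Complex.exp (H z) = f z) ∧
      ∀ z ∈ Metric.ball (0 : ℂ) R, H (conj z) = conj (H z) := by
  have hd : DifferentiableOn ℂ (fun z => deriv f z / f z) (Metric.ball 0 R) :=
    (hf.deriv Metric.isOpen_ball).div hf hne
  obtain ⟨H, hH0, hH⟩ := hd.isExactOn_ball.with_val_at 0 0
  have hHd : DifferentiableOn ℂ H (Metric.ball 0 R) := fun z hz =>
    (hH z hz).differentiableAt.differentiableWithinAt
  have hexp : ∀ z ∈ Metric.ball (0 : ℂ) R, Complex.exp (H z) = f z := by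
    have hE : ∀ z ∈ Metric.ball (0 : ℂ) R,
        HasDerivAt (fun z => f z * Complex.exp (-H z)) 0 z := by
      intro z hz
      have h1 := (hf.differentiableAt (Metric.isOpen_ball.mem_nhds hz)).hasDerivAt.mul
        (hH z hz).neg.cexp
      have h2 : deriv f z * Complex.exp (-H z) +
          f z * (Complex.exp (-H z) * -(deriv f z / f z)) = 0 := by
        rw [mul_neg, mul_neg, mul_left_comm, mul_div_cancel₀ _ (hne z hz)]
        ring
      rw [← h2]
      exact h1
    intro z hz
    have := Metric.isOpen_ball.is_const_of_deriv_eq_zero (convex_ball (0 : ℂ) R).isPreconnected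
      (fun z hz => (hE z hz).differentiableAt.differentiableWithinAt)
      (fun z hz => (hE z hz).deriv) hz (Metric.mem_ball_self hR)
    simp only [hH0, h0, neg_zero, Complex.exp_zero, mul_one, Complex.exp_neg] at this
    field_simp at this
    exact this.symm
  refine ⟨H, hHd, hH0, hexp, ?_⟩
  -- The conjugate of `H` is again a logarithm of `f` vanishing at `0`, hence equals `H`.
  have hK := eqOn_of_exp_eq (differentiableOn_conj_conj hHd) hHd (by simp [hH0]) (by
    intro z hz
    have hz' : conj z ∈ Metric.ball (0 : ℂ) R := by simpa using hz
    rw [Complex.exp_conj, hexp _ hz', hconj z hz, Complex.conj_conj, hexp z hz])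
  intro z hz
  rw [← hK hz, Complex.conj_conj]

/-! ### Real Taylor series and explicit bounds for their nonlinear part. -/

theorem HasSum.congr_terms {E : Type*} [AddCommMonoid E] [TopologicalSpace E] {f g : ℕ → E} {a : E}
    (h : HasSum f a) (e : ∀ m, g m = f m) : HasSum g a := (funext e : g = f) ▸ h

theorem iteratedDeriv_conj_of_conj_symm {R : ℝ} {f : ℂ → ℂ} (hR : 0 < R)
    (hf : DifferentiableOn ℂ f (Metric.ball 0 R))
    (hconj : ∀ z ∈ Metric.ball (0 : ℂ) R, f (conj z) = conj (f z)) (n : ℕ) :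
    conj (iteratedDeriv n f 0) = iteratedDeriv n f 0 := by
  have h : ∀ n : ℕ, DifferentiableOn ℂ (iteratedDeriv n f) (Metric.ball 0 R) ∧
      ∀ z ∈ Metric.ball (0 : ℂ) R, iteratedDeriv n f (conj z) = conj (iteratedDeriv n f z) := by
    intro n
    induction n with
    | zero => simpa using ⟨hf, by simpa using hconj⟩
    | succ n ih =>
      rw [iteratedDeriv_succ]
      refine ⟨ih.1.deriv Metric.isOpen_ball, fun z hz => ?_⟩
      have hz' : conj z ∈ Metric.ball (0 : ℂ) R := by simpa using hz
      have h1 := (ih.1.differentiableAt (Metric.isOpen_ball.mem_nhds hz)).hasDerivAt.conj_conj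
      refine (h1.congr_of_eventuallyEq ?_).deriv
      filter_upwards [Metric.isOpen_ball.mem_nhds hz'] with x hx
      have hx' : conj x ∈ Metric.ball (0 : ℂ) R := by simpa using hx
      have := ih.2 _ hx'
      rw [Complex.conj_conj] at this
      exact this
  have := (h n).2 0 (Metric.mem_ball_self hR)
  rw [map_zero] at this
  exact this.symm

/-- Taylor expansion at the origin of a bounded holomorphic function that is real on the real axis,
together with the expansion of `s f'(s)`. -/
theorem exists_real_taylor {R K : ℝ} {f : ℂ → ℂ} (hR : 0 < R)
    (hf : DifferentiableOn ℂ f (Metric.ball 0 R)) (h0 : f 0 = 0)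
    (hconj : ∀ z ∈ Metric.ball (0 : ℂ) R, f (conj z) = conj (f z))
    (hK : ∀ z ∈ Metric.ball (0 : ℂ) R, ‖f z‖ ≤ K) :
    ∃ c : ℕ → ℝ, c 0 = 0 ∧ (∀ m, |c m| ≤ K / R ^ m) ∧
      (∀ s ∈ Metric.ball (0 : ℂ) R, HasSum (fun m => (c m : ℂ) * s ^ m) (f s)) ∧
      ∀ s ∈ Metric.ball (0 : ℂ) R, HasSum (fun m => (c m * m : ℂ) * s ^ m) (s * deriv f s) := by
  have hreal : ∀ n, ((iteratedDeriv n f 0).re : ℂ) = iteratedDeriv n f 0 := fun n =>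
    Complex.conj_eq_iff_re.mp (iteratedDeriv_conj_of_conj_symm hR hf hconj n)
  refine ⟨fun m => (iteratedDeriv m f 0).re / m.factorial, by simp [h0], fun m => ?_, fun s hs => ?_,
    fun s hs => ?_⟩
  -- Cauchy's estimate needs a closed disc in the domain, hence `r < R` and then `r → R`.
  · have hb : ∀ r ∈ Set.Ioo 0 R, |(iteratedDeriv m f 0).re / m.factorial| * r ^ m ≤ K := by
      rintro r ⟨hr0, hrR⟩
      have hcl : DiffContOnCl ℂ f (Metric.ball 0 r) :=
        (hf.mono (Metric.closedBall_subset_ball hrR)).diffContOnCl_ball subset_rfl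
      have h := Complex.norm_iteratedDeriv_le_of_forall_mem_sphere_norm_le m hr0 hcl (C := K)
        fun z hz => hK z (Metric.sphere_subset_closedBall.trans
          (Metric.closedBall_subset_ball hrR) hz)
      rw [abs_div, Nat.abs_cast]
      have h2 := (Complex.abs_re_le_norm _).trans h
      have : (0 : ℝ) < m.factorial := by positivity
      rw [div_mul_eq_mul_div, div_le_iff₀ this]
      rw [le_div_iff₀ (by positivity)] at h2
      linarith
    have hlim : Tendsto (fun r : ℝ => |(iteratedDeriv m f 0).re / m.factorial| * r ^ m) (𝓝[<] R)
        (𝓝 (|(iteratedDeriv m f 0).re / m.factorial| * R ^ m)) :=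
      (Continuous.tendsto (by fun_prop) R).mono_left nhdsWithin_le_nhds
    rw [le_div_iff₀ (by positivity)]
    refine le_of_tendsto hlim ?_
    filter_upwards [Ioo_mem_nhdsLT hR] with r hr using hb r hr
  · have h := Complex.hasSum_taylorSeries_on_ball hf hs
    refine HasSum.congr_terms h fun m => ?_
    push_cast
    rw [hreal]
    simp only [sub_zero, smul_eq_mul]
    ring
  · have h := (Complex.hasSum_taylorSeries_on_ball (hf.deriv Metric.isOpen_ball) hs).mul_left s
    rw [← hasSum_nat_add_iff' 1]
    have h0 : ∑ i ∈ Finset.range 1, (((iteratedDeriv i f 0).re / i.factorial : ℝ) * i : ℂ) * s ^ i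
        = 0 := by simp
    rw [h0, sub_zero]
    refine HasSum.congr_terms h fun m => ?_
    rw [← iteratedDeriv_succ']
    push_cast
    rw [hreal, Nat.factorial_succ]
    have : (m.factorial : ℂ) ≠ 0 := by exact_mod_cast m.factorial_ne_zero
    have : (m + 1 : ℂ) ≠ 0 := by exact_mod_cast m.succ_ne_zero
    simp only [sub_zero, smul_eq_mul]
    push_cast
    field_simp
    ring

/-- Comparison of `∑ cₘ tₘ` with its linear term. -/
theorem abs_sub_linear_term_le {R K r δ T : ℝ} {c t : ℕ → ℝ} (hR : 0 < R) (hr : 0 ≤ r) (hrR : r < R)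
    (hK : 0 ≤ K) (hδ : 0 ≤ δ) (hc0 : c 0 = 0) (hc : ∀ m, |c m| ≤ K / R ^ m)
    (ht : ∀ m : ℕ, |t (m + 1)| ≤ (m + 1) ^ 2 * r ^ m * δ)
    (hT : HasSum (fun m => c m * t m) T) :
    |T - c 1 * t 1| ≤ δ * (K / R * (4 * (r / R) / (1 - r / R) ^ 3)) := by
  set x := r / R with hx
  have hx0 : 0 ≤ x := by positivity
  have hx1 : x < 1 := (div_lt_one hR).mpr hrR
  have h2 : HasSum (fun m => c (m + 2) * t (m + 2)) (T - c 1 * t 1) := by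
    have := (hasSum_nat_add_iff' 2).mpr hT
    simpa [Finset.sum_range_succ, hc0] using this
  -- The comparison uses `(m + 2)² ≤ 4 · C(m + 2, 2)` and `∑ C(m + 2, 2) xᵐ = (1 - x)⁻³`.
  have hg := (hasSum_choose_mul_geometric_of_norm_lt_one (𝕜 := ℝ) 2
    (r := x) (by rwa [Real.norm_of_nonneg hx0])).mul_left (δ * (K / R) * (4 * x))
  have hle : ∀ m, ‖c (m + 2) * t (m + 2)‖ ≤ δ * (K / R) * (4 * x) * (((m + 2).choose 2 : ℕ) * x ^ m) := by
    intro m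
    rw [Real.norm_eq_abs, abs_mul]
    have h3 := ht (m + 1)
    have hch : (((m + 2).choose 2 : ℕ) : ℝ) = (m + 2) * (m + 1) / 2 := by
      rw [Nat.cast_choose_two]; push_cast; ring
    rw [hch]
    calc |c (m + 2)| * |t (m + 2)| ≤ K / R ^ (m + 2) * (((m + 1 : ℕ) + 1) ^ 2 * r ^ (m + 1) * δ) := by
          gcongr
          exact hc _
      _ = δ * (K / R) * x * ((m + 2 : ℝ) ^ 2 * x ^ m) := by
          rw [hx, div_pow, pow_succ r, pow_succ R, pow_succ R]
          field_simp
          push_cast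
          ring
      _ ≤ δ * (K / R) * x * ((4 * ((m + 2) * (m + 1) / 2)) * x ^ m) := by
          gcongr
          nlinarith [(Nat.cast_nonneg m : (0 : ℝ) ≤ m)]
      _ = _ := by ring
  have h4 := tsum_of_norm_bounded hg hle
  rw [h2.tsum_eq, Real.norm_eq_abs] at h4
  refine h4.trans_eq ?_
  ring

theorem norm_pow_sub_pow_le {r : ℝ} (hr : 0 ≤ r) {a b : ℂ} (ha : ‖a‖ ≤ r) (hb : ‖b‖ ≤ r) (m : ℕ) :
    ‖a ^ (m + 1) - b ^ (m + 1)‖ ≤ (m + 1) * r ^ m * ‖a - b‖ := by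
  induction m with
  | zero => simp
  | succ m ih =>
    have h : a ^ (m + 1 + 1) - b ^ (m + 1 + 1) = a * (a ^ (m + 1) - b ^ (m + 1))
      + (a - b) * b ^ (m + 1) := by ring
    rw [h]
    calc _ ≤ ‖a‖ * ‖a ^ (m + 1) - b ^ (m + 1)‖ + ‖a - b‖ * ‖b‖ ^ (m + 1) := by
          refine (norm_add_le _ _).trans ?_
          rw [norm_mul, norm_mul, norm_pow]
      _ ≤ r * ((m + 1) * r ^ m * ‖a - b‖) + ‖a - b‖ * r ^ (m + 1) := by gcongr
      _ = _ := by push_cast; ring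

/-- If `|z| = p` then `|p - z|² = 2p(p - Re z)`. Applied to `s` and to `s^(m+1)`, this turns the
squared Lipschitz bound for powers into a bound linear in `r - Re s`, so every defect is measured by
the first one. -/
theorem abs_pow_sub_re_pow_le {r : ℝ} {s : ℂ} (hs : ‖s‖ = r) (m : ℕ) :
    |r ^ (m + 1) - (s ^ (m + 1)).re| ≤ (m + 1) ^ 2 * r ^ m * (r - s.re) := by
  have hr : 0 ≤ r := hs ▸ norm_nonneg s
  have hid : ∀ (p : ℝ) (z : ℂ), ‖z‖ = p → ‖(p : ℂ) - z‖ ^ 2 = 2 * p * (p - z.re) := by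
    intro p z hz
    have h1 : ‖z‖ ^ 2 = z.re ^ 2 + z.im ^ 2 := by
      rw [← Complex.normSq_eq_norm_sq, Complex.normSq_apply]; ring
    rw [← Complex.normSq_eq_norm_sq, Complex.normSq_apply]
    rw [hz] at h1
    simp only [Complex.sub_re, Complex.ofReal_re, Complex.sub_im, Complex.ofReal_im]
    nlinarith
  rcases hr.eq_or_lt with h0 | h0
  · have : s = 0 := norm_eq_zero.mp (hs.trans h0.symm)
    subst this
    simp [← h0]
  have hpow : ‖s ^ (m + 1)‖ = r ^ (m + 1) := by rw [norm_pow, hs]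
  have hnn : 0 ≤ r ^ (m + 1) - (s ^ (m + 1)).re := by
    have := Complex.re_le_norm (s ^ (m + 1)); rw [hpow] at this; linarith
  rw [abs_of_nonneg hnn]
  have h1 := hid _ _ hpow
  have h2 := hid _ _ hs
  have h3 := norm_pow_sub_pow_le hr (a := (r : ℂ)) (b := s) (by simp [abs_of_nonneg hr]) hs.le m
  have h4 : ‖(r : ℂ) ^ (m + 1) - s ^ (m + 1)‖ ^ 2 ≤ ((m + 1) * r ^ m * ‖(r : ℂ) - s‖) ^ 2 := by
    gcongr
  push_cast at h1
  rw [h1, mul_pow, h2] at h4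
  have h5 : r ^ (m + 1) * (r ^ (m + 1) - (s ^ (m + 1)).re) ≤
      r ^ (m + 1) * ((m + 1) ^ 2 * r ^ m * (r - s.re)) := by
    have : ((m + 1) * r ^ m) ^ 2 * (2 * r * (r - s.re)) =
      2 * (r ^ (m + 1) * ((m + 1) ^ 2 * r ^ m * (r - s.re))) := by ring
    linarith
  exact le_of_mul_le_mul_left h5 (by positivity)

/-- On the circle `‖s‖ = r`, the real part of a power series with real coefficients differs from its
value at `r` by the linear contribution up to a relative error. -/
theorem abs_sub_re_sub_linear_le {R K r : ℝ} {c : ℕ → ℝ} {f : ℂ → ℂ} {s : ℂ} (hR : 0 < R)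
    (hK : 0 ≤ K) (hrR : r < R) (hs : ‖s‖ = r) (hc0 : c 0 = 0) (hc : ∀ m, |c m| ≤ K / R ^ m)
    (hsum : ∀ s ∈ Metric.ball (0 : ℂ) R, HasSum (fun m => (c m : ℂ) * s ^ m) (f s)) :
    |(f r).re - (f s).re - c 1 * (r - s.re)| ≤
      (r - s.re) * (K / R * (4 * (r / R) / (1 - r / R) ^ 3)) := by
  have hr : 0 ≤ r := hs ▸ norm_nonneg s
  have h1 := Complex.hasSum_re (hsum s (by simpa [hs] using hrR))
  have h2 := Complex.hasSum_re (hsum r (by simpa [abs_of_nonneg hr] using hrR))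
  have h3 : HasSum (fun m => c m * (r ^ m - (s ^ m).re)) ((f r).re - (f s).re) := by
    refine HasSum.congr_terms (h2.sub h1) fun m => ?_
    rw [← Complex.ofReal_pow, ← Complex.ofReal_mul, Complex.ofReal_re, Complex.re_ofReal_mul]
    ring
  have hnn : 0 ≤ r - s.re := by
    have := Complex.re_le_norm s; rw [hs] at this; linarith
  have := abs_sub_linear_term_le hR hr hrR hK hnn hc0 hc
    (fun m => abs_pow_sub_re_pow_le hs m) h3
  simpa using this

/-- The Euler derivative contributes one factor `m` and the Lipschitz bound for powers another, so
the tail estimate is the same as for the angular defect. -/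
theorem abs_sub_eulerDeriv_sub_linear_le {R K r a b : ℝ} {c : ℕ → ℝ} {f : ℂ → ℂ} (hR : 0 < R)
    (hK : 0 ≤ K) (hrR : r < R) (ha : a ∈ Set.Icc 0 r) (hb : b ∈ Set.Icc 0 r) (hc0 : c 0 = 0)
    (hc : ∀ m, |c m| ≤ K / R ^ m)
    (hsum : ∀ s ∈ Metric.ball (0 : ℂ) R,
      HasSum (fun m => (c m * m : ℂ) * s ^ m) (s * deriv f s)) :
    |(a * deriv f a).re - (b * deriv f b).re - c 1 * (a - b)| ≤
      |a - b| * (K / R * (4 * (r / R) / (1 - r / R) ^ 3)) := by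
  have hr : 0 ≤ r := ha.1.trans ha.2
  have h1 := Complex.hasSum_re (hsum a (by simpa [abs_of_nonneg ha.1] using ha.2.trans_lt hrR))
  have h2 := Complex.hasSum_re (hsum b (by simpa [abs_of_nonneg hb.1] using hb.2.trans_lt hrR))
  have h3 : HasSum (fun m => c m * (m * (a ^ m - b ^ m)))
      ((a * deriv f a).re - (b * deriv f b).re) := by
    refine HasSum.congr_terms (h1.sub h2) fun m => ?_
    have h : ∀ x : ℝ, ((c m : ℂ) * m * (x : ℂ) ^ m).re = c m * m * x ^ m := fun x => by
      rw [← Complex.ofReal_natCast, ← Complex.ofReal_pow, ← Complex.ofReal_mul,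
        ← Complex.ofReal_mul, Complex.ofReal_re]
    rw [h, h]
    ring
  have := abs_sub_linear_term_le hR hr hrR hK (abs_nonneg (a - b)) hc0 hc (fun m => ?_) h3
  · simpa using this
  have h4 := norm_pow_sub_pow_le hr (a := (a : ℂ)) (b := b) (by simpa [abs_of_nonneg ha.1] using ha.2)
    (by simpa [abs_of_nonneg hb.1] using hb.2) m
  rw [← Complex.ofReal_sub, ← Complex.ofReal_pow, ← Complex.ofReal_pow, ← Complex.ofReal_sub,
    Complex.norm_real, Complex.norm_real, Real.norm_eq_abs, Real.norm_eq_abs] at h4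
  rw [abs_mul, Nat.abs_cast]
  push_cast
  calc _ ≤ ((m : ℝ) + 1) * ((m + 1) * r ^ m * |a - b|) := by gcongr
    _ = _ := by ring

/-! ### The disc coordinate at `ρ`; `Δ`, `E₄` and `j` as functions of `s = w³`. -/

theorem conj_ρ : conj (ρ : ℂ) = -1 - ρ := by
  apply Complex.ext
  · simp [ρ]; norm_num
  · simp [ρ]

theorem ρ_sq_add : (ρ : ℂ) ^ 2 + ρ + 1 = 0 := by rw [ρ_sq]; ring

theorem conj_ρ_sq_add : (conj (ρ : ℂ)) ^ 2 + conj (ρ : ℂ) + 1 = 0 := by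
  rw [conj_ρ]; linear_combination ρ_sq_add

/-- The Cayley transform from the unit disc to the upper half-plane sending `0` to `ρ`. -/
noncomputable def discTau (w : ℂ) : ℂ := (ρ + conj (ρ : ℂ) * w) / (1 + w)

/-- The inverse of `discTau`. -/
noncomputable def discCoord (τ : ℍ) : ℂ := (ρ - τ) / (τ - conj (ρ : ℂ))

theorem one_add_ne_zero_of_mem_ball {w : ℂ} (hw : w ∈ Metric.ball (0 : ℂ) 1) : 1 + w ≠ 0 := by
  intro h
  have : w = -1 := by linear_combination h
  simp [this] at hw

theorem im_discTau (w : ℂ) :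
    (discTau w).im = √3 / 2 * ((1 - ‖w‖ ^ 2) / ‖1 + w‖ ^ 2) := by
  rw [discTau, Complex.div_im, ← Complex.normSq_eq_norm_sq, ← Complex.normSq_eq_norm_sq]
  simp only [Complex.normSq_apply, Complex.add_re, Complex.add_im, Complex.one_re, Complex.one_im,
    Complex.mul_re, Complex.mul_im, Complex.conj_re, Complex.conj_im, ρ]
  ring

theorem im_discTau_pos {w : ℂ} (hw : w ∈ Metric.ball (0 : ℂ) 1) : 0 < (discTau w).im := by
  rw [im_discTau]
  have h1 : 0 < ‖1 + w‖ := norm_pos_iff.mpr (one_add_ne_zero_of_mem_ball hw)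
  have h2 : ‖w‖ < 1 := mem_ball_zero_iff.mp hw
  have h3 : 0 < 1 - ‖w‖ ^ 2 := by nlinarith [norm_nonneg w]
  positivity

theorem sub_conj_ρ_ne_zero (τ : ℍ) : (τ : ℂ) - conj (ρ : ℂ) ≠ 0 := by
  intro h
  have h1 := congrArg Complex.im h
  have h2 := τ.im_pos
  have h3 := ρ.im_pos
  simp at h1
  linarith

theorem ρ_sub_conj_ρ_ne_zero : (ρ : ℂ) - conj (ρ : ℂ) ≠ 0 := sub_conj_ρ_ne_zero ρ

theorem discTau_discCoord (τ : ℍ) : discTau (discCoord τ) = τ := by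
  have h1 := sub_conj_ρ_ne_zero τ
  have h2 := ρ_sub_conj_ρ_ne_zero
  have h3 : 1 + discCoord τ = (ρ - conj (ρ : ℂ)) / (τ - conj (ρ : ℂ)) := by
    rw [discCoord]; field_simp; ring
  rw [discTau, h3, discCoord]
  field_simp
  ring

theorem discCoord_mem_ball (τ : ℍ) : discCoord τ ∈ Metric.ball (0 : ℂ) 1 := by
  have h := im_discTau (discCoord τ)
  rw [discTau_discCoord] at h
  have h0 := τ.im_pos
  rw [← coe_im, h] at h0
  rw [mem_ball_zero_iff]
  by_contra! hle
  have : (1 - ‖discCoord τ‖ ^ 2) ≤ 0 := by nlinarith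
  have h2 : (1 - ‖discCoord τ‖ ^ 2) / ‖1 + discCoord τ‖ ^ 2 ≤ 0 :=
    div_nonpos_of_nonpos_of_nonneg this (by positivity)
  have : 0 ≤ √3 / 2 := by positivity
  nlinarith

theorem differentiableOn_discTau : DifferentiableOn ℂ discTau (Metric.ball 0 1) :=
  DifferentiableOn.div (by fun_prop) (by fun_prop) fun _ hw => one_add_ne_zero_of_mem_ball hw

/-- The point of the upper half-plane with disc coordinate `w`. -/
noncomputable def discPoint (w : ℂ) : ℍ := ofComplex (discTau w)

theorem coe_discPoint {w : ℂ} (hw : w ∈ Metric.ball (0 : ℂ) 1) :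
    (discPoint w : ℂ) = discTau w := by
  rw [discPoint, ofComplex_apply_of_im_pos (im_discTau_pos hw)]

theorem discPoint_discCoord (τ : ℍ) : discPoint (discCoord τ) = τ := by
  rw [discPoint, discTau_discCoord, ofComplex_apply]

theorem im_discPoint {w : ℂ} (hw : w ∈ Metric.ball (0 : ℂ) 1) :
    (discPoint w).im = √3 / 2 * ((1 - ‖w‖ ^ 2) / ‖1 + w‖ ^ 2) := by
  rw [← coe_im, coe_discPoint hw, im_discTau]

theorem conj_ρ_mul_mem_ball {w : ℂ} (hw : w ∈ Metric.ball (0 : ℂ) 1) :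
    conj (ρ : ℂ) * w ∈ Metric.ball (0 : ℂ) 1 := by
  rw [mem_ball_zero_iff] at hw ⊢
  simpa [norm_ρ] using hw

/-- `ST` fixes `ρ` and acts with order three, so it is a rotation in the coordinate centred there.
-/
theorem discPoint_rotate {w : ℂ} (hw : w ∈ Metric.ball (0 : ℂ) 1) :
    discPoint (conj (ρ : ℂ) * w) = ModularGroup.S • ModularGroup.T • discPoint w := by
  apply UpperHalfPlane.ext
  have hT : ((ModularGroup.T • discPoint w : ℍ) : ℂ) = discTau w + 1 := by
    have := ModularGroup.coe_T_zpow_smul_eq (z := discPoint w) (n := 1)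
    simpa [coe_discPoint hw] using this
  have hw' := conj_ρ_mul_mem_ball hw
  have h1 := one_add_ne_zero_of_mem_ball hw
  have h2 := one_add_ne_zero_of_mem_ball hw'
  have h3 : discTau w + 1 = -conj (ρ : ℂ) * (1 + conj (ρ : ℂ) * w) / (1 + w) := by
    rw [discTau, eq_div_iff h1]
    field_simp
    rw [conj_ρ]
    linear_combination w * ρ_sq_add
  rw [coe_discPoint hw', modular_S_smul]
  change _ = (-((ModularGroup.T • discPoint w : ℍ) : ℂ))⁻¹
  rw [hT, h3, discTau]
  have h4 : conj (ρ : ℂ) ≠ 0 := by simpa using ρ.ne_zero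
  rw [show -(-conj (ρ : ℂ) * (1 + conj (ρ : ℂ) * w) / (1 + w)) =
    conj (ρ : ℂ) * (1 + conj (ρ : ℂ) * w) / (1 + w) by ring, inv_div,
    div_eq_div_iff h2 (mul_ne_zero h4 h2)]
  have h5 : conj (ρ : ℂ) * ρ = 1 := by rw [conj_ρ]; linear_combination -ρ_sq_add
  have h6 : conj (ρ : ℂ) ^ 3 = 1 := by
    linear_combination (conj (ρ : ℂ) - 1) * conj_ρ_sq_add
  linear_combination (1 + conj (ρ : ℂ) * w) * h5 + (1 + conj (ρ : ℂ) * w) * w * h6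

/-- The factor is a constant times a ratio of values of `1 + w`. Dividing a form of weight `k` by
`(1 + w)^k` therefore leaves only `(-ρ̄)^k`, which is `1` for `k = 12` and `ρ̄` for `k = 4`. -/
theorem automorphy_factor_rotate {w : ℂ} (hw : w ∈ Metric.ball (0 : ℂ) 1) :
    denom ModularGroup.S (ModularGroup.T • discPoint w : ℍ) =
      -conj (ρ : ℂ) * (1 + conj (ρ : ℂ) * w) / (1 + w) := by
  have hT : ((ModularGroup.T • discPoint w : ℍ) : ℂ) = discTau w + 1 := by
    have := ModularGroup.coe_T_zpow_smul_eq (z := discPoint w) (n := 1)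
    simpa [coe_discPoint hw] using this
  have h1 := one_add_ne_zero_of_mem_ball hw
  rw [ModularGroup.denom_S, hT, discTau, eq_div_iff h1]
  field_simp
  rw [conj_ρ]
  linear_combination w * ρ_sq_add

theorem denom_T (τ : ℍ) : denom ModularGroup.T τ = 1 := by
  rw [ModularGroup.denom_apply]
  simp [ModularGroup.T]

/-- The discriminant in the disc coordinate, with its automorphy factor removed. -/
noncomputable def discDelta (w : ℂ) : ℂ := discriminant (discPoint w) / (1 + w) ^ 12

/-- The Eisenstein series `E₄` in the disc coordinate, with its automorphy factor removed. -/
noncomputable def discE₄ (w : ℂ) : ℂ := E₄ (discPoint w) / (1 + w) ^ 4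

theorem discDelta_rotate {w : ℂ} (hw : w ∈ Metric.ball (0 : ℂ) 1) :
    discDelta (conj (ρ : ℂ) * w) = discDelta w := by
  have h1 := one_add_ne_zero_of_mem_ball hw
  have h2 := one_add_ne_zero_of_mem_ball (conj_ρ_mul_mem_ball hw)
  have h6 : conj (ρ : ℂ) ^ 3 = 1 := by
    linear_combination (conj (ρ : ℂ) - 1) * conj_ρ_sq_add
  rw [discDelta, discPoint_rotate hw, discriminant_smul, discriminant_smul,
    automorphy_factor_rotate hw, denom_T, discDelta]
  field_simp
  rw [show conj (ρ : ℂ) ^ 12 = (conj (ρ : ℂ) ^ 3) ^ 4 by ring, h6]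
  simp

theorem discE₄_rotate {w : ℂ} (hw : w ∈ Metric.ball (0 : ℂ) 1) :
    discE₄ (conj (ρ : ℂ) * w) = conj (ρ : ℂ) * discE₄ w := by
  have h1 := one_add_ne_zero_of_mem_ball hw
  have h2 := one_add_ne_zero_of_mem_ball (conj_ρ_mul_mem_ball hw)
  have h6 : conj (ρ : ℂ) ^ 3 = 1 := by
    linear_combination (conj (ρ : ℂ) - 1) * conj_ρ_sq_add
  rw [discE₄, discPoint_rotate hw, E₄_smul, E₄_smul,
    automorphy_factor_rotate hw, denom_T, discE₄]
  field_simp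
  rw [show conj (ρ : ℂ) ^ 4 = conj (ρ : ℂ) ^ 3 * conj (ρ : ℂ) by ring, h6]
  simp

theorem differentiableOn_discDelta : DifferentiableOn ℂ discDelta (Metric.ball 0 1) :=
  (differentiableOn_discriminant.comp differentiableOn_discTau fun _ hw => im_discTau_pos hw).div
    (by fun_prop) fun _ hw => pow_ne_zero _ (one_add_ne_zero_of_mem_ball hw)

theorem differentiableOn_discE₄ : DifferentiableOn ℂ discE₄ (Metric.ball 0 1) :=
  (differentiableOn_E₄.comp differentiableOn_discTau fun _ hw => im_discTau_pos hw).div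
    (by fun_prop) fun _ hw => pow_ne_zero _ (one_add_ne_zero_of_mem_ball hw)

/-- Conjugating `w` reflects `τ` in the line `Re τ = -1/2` and conjugates `q`. Rational
`q`-coefficients then make all the disc functions real for real `w`. -/
theorem coe_discPoint_conj {w : ℂ} (hw : w ∈ Metric.ball (0 : ℂ) 1) :
    (discPoint (conj w) : ℂ) = -1 - conj (discPoint w : ℂ) := by
  have hw' : conj w ∈ Metric.ball (0 : ℂ) 1 := by simpa using hw
  have h1 := one_add_ne_zero_of_mem_ball hw'
  rw [coe_discPoint hw, coe_discPoint hw', discTau, discTau]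
  simp only [map_div₀, map_add, map_mul, map_one, Complex.conj_conj]
  rw [eq_sub_iff_add_eq, ← add_div, div_eq_iff h1, conj_ρ]
  ring

theorem eisensteinSeries_conj {k : ℕ} (hk : 3 ≤ k) (hk2 : Even k) {τ τ' : ℍ}
    (h : (τ' : ℂ) = -1 - conj (τ : ℂ)) : E hk τ' = conj (E hk τ) := by
  have hq : Complex.exp (2 * Real.pi * Complex.I * τ') =
      conj (Complex.exp (2 * Real.pi * Complex.I * τ)) := by
    rw [← Complex.exp_conj, h, Complex.exp_eq_exp_iff_exists_int]
    refine ⟨-1, ?_⟩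
    simp only [map_mul, Complex.conj_I, Complex.conj_ofReal, map_ofNat]
    push_cast
    ring
  rw [EisensteinSeries.q_expansion_bernoulli hk hk2, EisensteinSeries.q_expansion_bernoulli hk hk2,
    hq, map_sub, map_mul, Complex.conj_tsum]
  simp only [map_mul, map_zpow₀, map_one, map_div₀, map_natCast, map_ofNat, map_ratCast]

theorem discriminant_conj {τ τ' : ℍ} (h : (τ' : ℂ) = -1 - conj (τ : ℂ)) :
    discriminant τ' = conj (discriminant τ) := by
  rw [discriminant_eq_E₄_cube_sub_E₆_sq, discriminant_eq_E₄_cube_sub_E₆_sq,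
    eisensteinSeries_conj _ ⟨2, rfl⟩ h, eisensteinSeries_conj _ ⟨3, rfl⟩ h]
  simp only [map_div₀, map_sub, map_pow, map_ofNat]

theorem discDelta_conj {w : ℂ} (hw : w ∈ Metric.ball (0 : ℂ) 1) :
    discDelta (conj w) = conj (discDelta w) := by
  rw [discDelta, discriminant_conj (coe_discPoint_conj hw), discDelta]
  simp

theorem discE₄_conj {w : ℂ} (hw : w ∈ Metric.ball (0 : ℂ) 1) :
    discE₄ (conj w) = conj (discE₄ w) := by
  rw [discE₄, eisensteinSeries_conj _ ⟨2, rfl⟩ (coe_discPoint_conj hw), discE₄]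
  simp

theorem discE₄_zero : discE₄ 0 = 0 := by
  have h := discE₄_rotate (w := 0) (Metric.mem_ball_self one_pos)
  rw [mul_zero] at h
  have h1 : (1 - conj (ρ : ℂ)) ≠ 0 := by
    rw [conj_ρ]
    intro h
    have := congrArg Complex.im h
    simp only [Complex.sub_im, Complex.one_im, Complex.neg_im, Complex.zero_im] at this
    have := ρ.im_pos
    rw [← coe_im] at this
    linarith
  have : (1 - conj (ρ : ℂ)) * discE₄ 0 = 0 := by linear_combination h
  exact (mul_eq_zero.mp this).resolve_left h1

theorem discDelta_ne_zero {w : ℂ} (hw : w ∈ Metric.ball (0 : ℂ) 1) : discDelta w ≠ 0 :=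
  div_ne_zero (discriminant_ne_zero _) (pow_ne_zero _ (one_add_ne_zero_of_mem_ball hw))

theorem mem_ball_pow_three {w : ℂ} (hw : w ∈ Metric.ball (0 : ℂ) 1) :
    w ^ 3 ∈ Metric.ball (0 : ℂ) 1 := by
  rw [mem_ball_zero_iff] at hw ⊢
  rw [norm_pow]
  exact pow_lt_one₀ (norm_nonneg _) hw (by norm_num)

theorem exists_pow_three_eq {s : ℂ} (hs : s ∈ Metric.ball (0 : ℂ) 1) :
    ∃ w ∈ Metric.ball (0 : ℂ) 1, w ^ 3 = s :=
  ⟨_, mem_ball_zero_iff.mpr (norm_lt_one_of_pow_three (cpow_third_pow s) (mem_ball_zero_iff.mp hs)),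
    cpow_third_pow s⟩

theorem exists_deltaHat : ∃ H : ℂ → ℂ, DifferentiableOn ℂ H (Metric.ball 0 1) ∧
    ∀ w ∈ Metric.ball (0 : ℂ) 1, H (w ^ 3) = discDelta w :=
  exists_eq_comp_cube differentiableOn_discDelta conj_ρ_sq_add fun _ hw => discDelta_rotate hw

theorem exists_eHat : ∃ H : ℂ → ℂ, DifferentiableOn ℂ H (Metric.ball 0 1) ∧
    ∀ w ∈ Metric.ball (0 : ℂ) 1, H (w ^ 3) = dslope discE₄ 0 w := by
  refine exists_eq_comp_cube ((Complex.differentiableOn_dslope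
    (Metric.ball_mem_nhds 0 one_pos)).mpr differentiableOn_discE₄) conj_ρ_sq_add fun w hw => ?_
  rcases eq_or_ne w 0 with rfl | h0
  · rw [mul_zero]
  have h4 : conj (ρ : ℂ) ≠ 0 := by simpa using ρ.ne_zero
  rw [dslope_of_ne _ h0, dslope_of_ne _ (mul_ne_zero h4 h0), slope_def_field, slope_def_field,
    discE₄_rotate hw, discE₄_zero]
  simp only [sub_zero]
  rw [mul_div_mul_left _ _ h4]

/-- `discDelta` as a function of the cube of the disc coordinate. -/
noncomputable def deltaHat : ℂ → ℂ := exists_deltaHat.choose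

/-- `discE₄ w / w` as a function of the cube of the disc coordinate. -/
noncomputable def eHat : ℂ → ℂ := exists_eHat.choose

theorem differentiableOn_deltaHat : DifferentiableOn ℂ deltaHat (Metric.ball 0 1) :=
  exists_deltaHat.choose_spec.1

theorem deltaHat_pow {w : ℂ} (hw : w ∈ Metric.ball (0 : ℂ) 1) : deltaHat (w ^ 3) = discDelta w :=
  exists_deltaHat.choose_spec.2 w hw

theorem differentiableOn_eHat : DifferentiableOn ℂ eHat (Metric.ball 0 1) :=
  exists_eHat.choose_spec.1

theorem eHat_pow {w : ℂ} (hw : w ∈ Metric.ball (0 : ℂ) 1) : eHat (w ^ 3) = dslope discE₄ 0 w :=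
  exists_eHat.choose_spec.2 w hw

theorem mul_eHat_pow {w : ℂ} (hw : w ∈ Metric.ball (0 : ℂ) 1) : w * eHat (w ^ 3) = discE₄ w := by
  rw [eHat_pow hw]
  simpa [discE₄_zero] using sub_smul_dslope discE₄ 0 w

theorem deltaHat_ne_zero {s : ℂ} (hs : s ∈ Metric.ball (0 : ℂ) 1) : deltaHat s ≠ 0 := by
  obtain ⟨w, hw, rfl⟩ := exists_pow_three_eq hs
  rw [deltaHat_pow hw]
  exact discDelta_ne_zero hw

theorem deltaHat_conj {s : ℂ} (hs : s ∈ Metric.ball (0 : ℂ) 1) :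
    deltaHat (conj s) = conj (deltaHat s) := by
  obtain ⟨w, hw, rfl⟩ := exists_pow_three_eq hs
  rw [map_pow (starRingEnd ℂ), deltaHat_pow (by simpa using hw), deltaHat_pow hw, discDelta_conj hw]

theorem eHat_conj {s : ℂ} (hs : s ∈ Metric.ball (0 : ℂ) 1) :
    eHat (conj s) = conj (eHat s) := by
  rcases eq_or_ne s 0 with rfl | h0
  · have hc : ∀ᶠ s in 𝓝[≠] (0 : ℂ), eHat (conj s) = conj (eHat s) := by
      filter_upwards [self_mem_nhdsWithin,
        mem_nhdsWithin_of_mem_nhds (Metric.ball_mem_nhds (0 : ℂ) one_pos)] with s h0 hs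
      obtain ⟨w, hw, rfl⟩ := exists_pow_three_eq hs
      have hw0 : w ≠ 0 := fun h => h0 (by simp [h])
      have hw' : conj w ∈ Metric.ball (0 : ℂ) 1 := by simpa using hw
      have h1 := mul_eHat_pow hw'
      rw [discE₄_conj hw, ← mul_eHat_pow hw, map_mul] at h1
      rw [map_pow (starRingEnd ℂ)]
      exact mul_left_cancel₀ (by simpa using hw0) h1
    have hcont : ContinuousAt eHat 0 :=
      (differentiableOn_eHat.differentiableAt (Metric.ball_mem_nhds 0 one_pos)).continuousAt
    have h1 : ContinuousAt (fun s : ℂ => eHat (conj s)) 0 :=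
      ContinuousAt.comp' (by simpa using hcont) Complex.continuous_conj.continuousAt
    have h2 : ContinuousAt (fun s : ℂ => conj (eHat s)) 0 :=
      Complex.continuous_conj.continuousAt.comp' hcont
    exact tendsto_nhds_unique_of_eventuallyEq (h1.tendsto.mono_left nhdsWithin_le_nhds)
      (h2.tendsto.mono_left nhdsWithin_le_nhds) hc
  · obtain ⟨w, hw, rfl⟩ := exists_pow_three_eq hs
    have hw0 : w ≠ 0 := fun h => h0 (by simp [h])
    have hw' : conj w ∈ Metric.ball (0 : ℂ) 1 := by simpa using hw
    have h1 := mul_eHat_pow hw'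
    rw [discE₄_conj hw, ← mul_eHat_pow hw, map_mul] at h1
    rw [map_pow (starRingEnd ℂ)]
    exact mul_left_cancel₀ (by simpa using hw0) h1

/-- The `j`-invariant as a function of the cube of the disc coordinate. -/
noncomputable def jHat (s : ℂ) : ℂ := s * eHat s ^ 3 / deltaHat s

theorem jInv_discPoint {w : ℂ} (hw : w ∈ Metric.ball (0 : ℂ) 1) :
    jInv (discPoint w) = jHat (w ^ 3) := by
  have h1 := one_add_ne_zero_of_mem_ball hw
  have h2 := discriminant_ne_zero (discPoint w)
  rw [jHat, ← mul_pow, mul_eHat_pow hw, deltaHat_pow hw, discE₄, discDelta, jInv]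
  field_simp

theorem im_pow_six_mul_norm_discriminant {w : ℂ} (hw : w ∈ Metric.ball (0 : ℂ) 1) :
    (discPoint w).im ^ 6 * ‖discriminant (discPoint w)‖ =
      27 / 64 * ((1 - ‖w‖ ^ 2) ^ 6 * ‖deltaHat (w ^ 3)‖) := by
  have h1 : ‖1 + w‖ ≠ 0 := norm_ne_zero_iff.mpr (one_add_ne_zero_of_mem_ball hw)
  rw [im_discPoint hw, deltaHat_pow hw, discDelta, norm_div, norm_pow, mul_pow, div_pow, div_pow,
    show √3 ^ 6 = (√3 ^ 2) ^ 3 by ring, Real.sq_sqrt (by norm_num)]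
  field_simp
  norm_num
  ring

theorem im_sq_mul_norm_E₄ {w : ℂ} (hw : w ∈ Metric.ball (0 : ℂ) 1) :
    (discPoint w).im ^ 2 * ‖E₄ (discPoint w)‖ =
      3 / 4 * ((1 - ‖w‖ ^ 2) ^ 2 * ‖discE₄ w‖) := by
  have h1 : ‖1 + w‖ ≠ 0 := norm_ne_zero_iff.mpr (one_add_ne_zero_of_mem_ball hw)
  rw [im_discPoint hw, discE₄, norm_div, norm_pow, mul_pow, div_pow, div_pow,
    Real.sq_sqrt (by norm_num)]
  field_simp
  norm_num
  ring

/-! ### Bounds for `Δ` and `E₄` from their `q`-expansions. -/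

/-- The absolute value of `q = exp (2πiτ)`. -/
noncomputable def qAbs (τ : ℍ) : ℝ := Real.exp (-(2 * Real.pi * τ.im))

theorem qAbs_pos (τ : ℍ) : 0 < qAbs τ := Real.exp_pos _

theorem qAbs_lt_one (τ : ℍ) : qAbs τ < 1 := by
  have := τ.im_pos
  have := Real.pi_pos
  rw [qAbs, Real.exp_lt_one_iff]
  have : 0 < 2 * Real.pi * τ.im := by positivity
  linarith

theorem norm_qParam_one (τ : ℍ) : ‖Function.Periodic.qParam 1 (τ : ℂ)‖ = qAbs τ := by
  rw [Function.Periodic.norm_qParam, qAbs, coe_im]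
  congr 1
  ring

theorem tendsto_prod_discriminant (τ : ℍ) :
    Tendsto (fun n => qAbs τ * ∏ i ∈ Finset.range n,
      ‖1 - Function.Periodic.qParam 1 (τ : ℂ) ^ (i + 1)‖ ^ 24) atTop (𝓝 ‖discriminant τ‖) := by
  have h := (multipliableLocallyUniformlyOn_eta.multipliable τ.2).pow 24
  have h2 := h.hasProd.tendsto_prod_nat.norm.const_mul ‖Function.Periodic.qParam 1 (τ : ℂ)‖
  rw [← norm_mul, ← discriminant_eq_q_prod, norm_qParam_one] at h2
  refine h2.congr fun n => ?_
  rw [norm_prod]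
  simp only [norm_pow]

theorem norm_discriminant_le (τ : ℍ) :
    ‖discriminant τ‖ ≤ Real.exp (-(2 * Real.pi * τ.im) + 24 * (qAbs τ / (1 - qAbs τ))) := by
  have h0 := qAbs_pos τ
  have h1 := qAbs_lt_one τ
  refine le_of_tendsto (tendsto_prod_discriminant τ) (Eventually.of_forall fun n => ?_)
  rw [Real.exp_add, ← qAbs]
  gcongr
  calc ∏ i ∈ Finset.range n, ‖1 - Function.Periodic.qParam 1 (τ : ℂ) ^ (i + 1)‖ ^ 24
      ≤ ∏ i ∈ Finset.range n, Real.exp (24 * qAbs τ ^ (i + 1)) := by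
        refine Finset.prod_le_prod (fun _ _ => by positivity) fun i _ => ?_
        rw [show (24 : ℝ) * qAbs τ ^ (i + 1) = (24 : ℕ) * qAbs τ ^ (i + 1) by norm_num,
          Real.exp_nat_mul]
        gcongr
        calc _ ≤ ‖(1 : ℂ)‖ + ‖Function.Periodic.qParam 1 (τ : ℂ) ^ (i + 1)‖ := norm_sub_le _ _
          _ = qAbs τ ^ (i + 1) + 1 := by rw [norm_one, norm_pow, norm_qParam_one]; ring
          _ ≤ _ := Real.add_one_le_exp _
    _ = Real.exp (24 * ∑ i ∈ Finset.range n, qAbs τ ^ (i + 1)) := by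
        rw [← Real.exp_sum, Finset.mul_sum]
    _ ≤ _ := by
        gcongr
        have hs : HasSum (fun i => qAbs τ ^ (i + 1)) (qAbs τ / (1 - qAbs τ)) := by
          simpa [pow_succ', div_eq_mul_inv] using
            (hasSum_geometric_of_lt_one h0.le h1).mul_left (qAbs τ)
        exact sum_le_hasSum _ (fun _ _ => by positivity) hs

theorem exp_neg_div_le_one_sub {x t : ℝ} (hx : 0 ≤ x) (hxt : x ≤ t) (ht : t < 1) :
    Real.exp (-(x / (1 - t))) ≤ 1 - x := by
  have h1 : 0 < 1 - t := by linarith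
  have h2 : 0 < 1 - x := by linarith
  have h3 := Real.add_one_le_exp (x / (1 - t))
  rw [Real.exp_neg, inv_le_comm₀ (Real.exp_pos _) h2]
  refine le_trans ?_ h3
  rw [inv_eq_one_div, div_le_iff₀ h2]
  have h4 : x ≤ x / (1 - t) * (1 - x) := by
    rw [div_mul_eq_mul_div, le_div_iff₀ h1]
    nlinarith
  linarith

/-- The first factor of the product is kept exactly, because for `Re τ = -1/2` it equals `1 + |q|`
and must not be bounded by `1 - |q|`. The later factors cost only second order in `|q|`. -/
theorem le_norm_discriminant (τ : ℍ) :
    qAbs τ * ‖1 - Function.Periodic.qParam 1 (τ : ℂ)‖ ^ 24 *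
      Real.exp (-(24 * (qAbs τ / (1 - qAbs τ)) ^ 2)) ≤ ‖discriminant τ‖ := by
  have h0 := qAbs_pos τ
  have h1 := qAbs_lt_one τ
  have h1' : 0 < 1 - qAbs τ := by linarith
  refine ge_of_tendsto ((tendsto_add_atTop_iff_nat 1).mpr (tendsto_prod_discriminant τ))
    (Eventually.of_forall fun n => ?_)
  rw [Finset.prod_range_succ', zero_add, pow_one, mul_assoc,
    mul_comm (∏ i ∈ Finset.range n, _)]
  gcongr
  calc Real.exp (-(24 * (qAbs τ / (1 - qAbs τ)) ^ 2))
      ≤ Real.exp (∑ i ∈ Finset.range n, 24 * -(qAbs τ ^ (i + 2) / (1 - qAbs τ))) := by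
        gcongr
        have hs : HasSum (fun i => qAbs τ ^ (i + 2) / (1 - qAbs τ))
            ((qAbs τ / (1 - qAbs τ)) ^ 2) := by
          have := (hasSum_geometric_of_lt_one h0.le h1).mul_left (qAbs τ ^ 2 / (1 - qAbs τ))
          rw [show qAbs τ ^ 2 / (1 - qAbs τ) * (1 - qAbs τ)⁻¹ = (qAbs τ / (1 - qAbs τ)) ^ 2 by
            rw [div_pow]; field_simp] at this
          exact this.congr_terms fun i => by rw [pow_add]; ring
        have := sum_le_hasSum (Finset.range n) (fun _ _ => by positivity) hs
        rw [← Finset.mul_sum, Finset.sum_neg_distrib]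
        linarith
    _ = ∏ i ∈ Finset.range n, Real.exp (-(qAbs τ ^ (i + 2) / (1 - qAbs τ))) ^ 24 := by
        rw [Real.exp_sum]
        refine Finset.prod_congr rfl fun i _ => ?_
        rw [← Real.exp_nat_mul]
        norm_num
    _ ≤ _ := by
        refine Finset.prod_le_prod (fun _ _ => by positivity) fun i _ => ?_
        gcongr
        refine (exp_neg_div_le_one_sub (by positivity) ?_ h1).trans ?_
        · exact pow_le_of_le_one h0.le h1.le (by simp)
        · have := norm_sub_norm_le (1 : ℂ) (Function.Periodic.qParam 1 (τ : ℂ) ^ (i + 1 + 1))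
          rwa [norm_one, norm_pow, norm_qParam_one] at this

/-- With `n = m + 1`, `σ₃(n) ≤ n⁴ ≤ (2ᵐ)⁴`; the majorant is geometric of ratio `16|z|`. -/
theorem norm_sigma_mul_pow_le {z : ℂ} (n : ℕ+) :
    ‖(ArithmeticFunction.sigma 3 n : ℂ) * z ^ (n : ℤ)‖ ≤
      ‖z‖ * (16 * ‖z‖) ^ (Equiv.pnatEquivNat n) := by
  obtain ⟨m, hm⟩ : ∃ m : ℕ, (n : ℕ) = m + 1 := ⟨n.natPred, n.natPred_add_one.symm⟩
  have hm' : Equiv.pnatEquivNat n = m := by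
    have : n.natPred = m := by rw [PNat.natPred, hm]; simp
    exact this
  rw [norm_mul, zpow_natCast, norm_pow, hm', hm, Complex.norm_natCast]
  have h5 := ArithmeticFunction.sigma_le_pow_succ 3 (m + 1)
  have h6 : m + 1 ≤ 2 ^ m := Nat.lt_two_pow_self
  have h7 : (m + 1) ^ (3 + 1) ≤ (2 ^ m) ^ 4 := Nat.pow_le_pow_left h6 4
  have h8 : (2 ^ m) ^ 4 = 16 ^ m := by rw [← pow_mul, mul_comm m 4, pow_mul]; norm_num
  have h4 : (ArithmeticFunction.sigma 3 (m + 1) : ℝ) ≤ 16 ^ m := by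
    exact_mod_cast (h5.trans h7).trans_eq h8
  calc _ ≤ (16 : ℝ) ^ m * ‖z‖ ^ (m + 1) := by gcongr
    _ = _ := by rw [mul_pow]; ring

theorem norm_tsum_sigma_mul_pow_le {z : ℂ} (h : 16 * ‖z‖ < 1) :
    ‖∑' n : ℕ+, (ArithmeticFunction.sigma 3 n : ℂ) * z ^ (n : ℤ)‖ ≤
      ‖z‖ / (1 - 16 * ‖z‖) := by
  have hg := (hasSum_geometric_of_lt_one (by positivity) h).mul_left ‖z‖
  rw [← div_eq_mul_inv] at hg
  exact tsum_of_norm_bounded ((Equiv.hasSum_iff Equiv.pnatEquivNat).mpr hg) norm_sigma_mul_pow_le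

theorem norm_E₄_sub_one_le {τ : ℍ} (h : 16 * qAbs τ < 1) :
    ‖E₄ τ - 1‖ ≤ 240 * (qAbs τ / (1 - 16 * qAbs τ)) := by
  have hexp : ‖Complex.exp (2 * Real.pi * Complex.I * τ)‖ = qAbs τ := by
    rw [← norm_qParam_one, Function.Periodic.qParam]
    simp
  have hE : E₄ τ = 1 + 240 * ∑' n : ℕ+, (ArithmeticFunction.sigma 3 n : ℂ) *
      Complex.exp (2 * Real.pi * Complex.I * τ) ^ (n : ℤ) := by
    rw [EisensteinSeries.q_expansion_bernoulli _ ⟨2, rfl⟩,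
      show bernoulli 4 = -1 / 30 by decide +kernel]
    norm_num
  rw [hE, add_sub_cancel_left, norm_mul, ← hexp]
  rw [← hexp] at h
  have := norm_tsum_sigma_mul_pow_le h
  have h240 : ‖(240 : ℂ)‖ = 240 := by simp
  rw [h240]
  gcongr

/-! ### Numerical bounds, and the size of `Δ(ρ)`. -/

theorem exp_le_taylor {x : ℝ} (h0 : 0 ≤ x) (h1 : x ≤ 1) :
    Real.exp x ≤ 1 + x + x ^ 2 / 2 + x ^ 3 / 6 + x ^ 4 * (5 / 96) := by
  have := Real.exp_bound' h0 h1 (n := 4) (by norm_num)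
  norm_num [Finset.sum_range_succ, Nat.factorial] at this
  linarith

theorem taylor_le_exp {x : ℝ} (h0 : 0 ≤ x) :
    1 + x + x ^ 2 / 2 + x ^ 3 / 6 + x ^ 4 / 24 ≤ Real.exp x := by
  have := Real.sum_le_exp_of_nonneg h0 5
  norm_num [Finset.sum_range_succ, Nat.factorial] at this
  linarith

theorem sqrt_three_bounds : 1.73205 < √3 ∧ √3 < 1.732051 :=
  ⟨Real.lt_sqrt_of_sq_lt (by norm_num), (Real.sqrt_lt' (by norm_num)).mpr (by norm_num)⟩

theorem pi_mul_sqrt_three_bounds : 5.44139 < Real.pi * √3 ∧ Real.pi * √3 < 5.441405 := by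
  obtain ⟨h1, h2⟩ := sqrt_three_bounds
  have h3 := Real.pi_gt_d6
  have h4 := Real.pi_lt_d6
  constructor <;> nlinarith

/-- Bounds for an exponential from bounds for a quarter of the fractional part of the exponent. -/
theorem exp_le_of_le {x : ℝ} (n : ℕ) (u : ℝ) (hx : x ≤ n + 4 * u) (h0 : 0 ≤ u) (h1 : u ≤ 1) :
    Real.exp x ≤ 2.7182818286 ^ n * (1 + u + u ^ 2 / 2 + u ^ 3 / 6 + u ^ 4 * (5 / 96)) ^ 4 := by
  have h : Real.exp x ≤ Real.exp 1 ^ n * Real.exp u ^ 4 := by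
    rw [← Real.exp_nat_mul, ← Real.exp_nat_mul, ← Real.exp_add]
    gcongr
    push_cast
    linarith
  refine h.trans ?_
  gcongr
  · exact Real.exp_one_lt_d9.le
  · exact exp_le_taylor h0 h1

theorem le_exp_of_le {x : ℝ} (n : ℕ) (u : ℝ) (hx : n + 4 * u ≤ x) (h0 : 0 ≤ u) :
    2.7182818283 ^ n * (1 + u + u ^ 2 / 2 + u ^ 3 / 6 + u ^ 4 / 24) ^ 4 ≤ Real.exp x := by
  have h : Real.exp 1 ^ n * Real.exp u ^ 4 ≤ Real.exp x := by
    rw [← Real.exp_nat_mul, ← Real.exp_nat_mul, ← Real.exp_add]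
    gcongr
    push_cast
    linarith
  refine le_trans ?_ h
  gcongr
  · exact Real.exp_one_gt_d9.le
  · exact taylor_le_exp h0

theorem exp_neg_le_of_le {x c : ℝ} (hc : 0 < c) (h : c⁻¹ ≤ Real.exp x) : Real.exp (-x) ≤ c := by
  rw [Real.exp_neg, inv_le_comm₀ (Real.exp_pos _) hc]
  exact h

theorem le_exp_neg_of_le {x c : ℝ} (hc : 0 < c) (h : Real.exp x ≤ c⁻¹) : c ≤ Real.exp (-x) := by
  rw [Real.exp_neg, le_inv_comm₀ hc (Real.exp_pos _)]
  exact h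

theorem exp_neg_pi_mul_sqrt_three_bounds :
    0.00433 ≤ Real.exp (-(Real.pi * √3)) ∧ Real.exp (-(Real.pi * √3)) ≤ 0.00434 := by
  obtain ⟨h1, h2⟩ := pi_mul_sqrt_three_bounds
  constructor
  · refine le_exp_neg_of_le (by norm_num) ((exp_le_of_le 5 0.11036 (by norm_num; linarith)
      (by norm_num) (by norm_num)).trans (by norm_num))
  · refine exp_neg_le_of_le (by norm_num) (le_trans (by norm_num) (le_exp_of_le 5 0.1103
      (by norm_num; linarith) (by norm_num)))

theorem qAbs_ρ : qAbs ρ = Real.exp (-(Real.pi * √3)) := by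
  rw [qAbs]
  congr 1
  change -(2 * Real.pi * (√3 / 2)) = _
  ring

theorem qParam_of_re_eq_neg_half {τ : ℍ} (h : τ.re = -1 / 2) :
    Function.Periodic.qParam 1 (τ : ℂ) = -(qAbs τ : ℂ) := by
  have h2 : (τ : ℂ) = -1 / 2 + τ.im * Complex.I := by
    apply Complex.ext <;> simp [h]
  rw [Function.Periodic.qParam, h2, qAbs]
  have h3 : 2 * Real.pi * Complex.I * (-1 / 2 + τ.im * Complex.I) / (1 : ℝ) =
      ((-(2 * Real.pi * τ.im) : ℝ) : ℂ) - Real.pi * Complex.I := by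
    push_cast
    linear_combination (2 * Real.pi * τ.im : ℂ) * Complex.I_sq
  rw [h3, Complex.exp_sub, Complex.exp_pi_mul_I]
  push_cast
  ring

theorem le_log_norm_discriminant {τ : ℍ} (h : τ.re = -1 / 2) :
    -(2 * Real.pi * τ.im) + 24 * (qAbs τ / (1 + qAbs τ)) - 24 * (qAbs τ / (1 - qAbs τ)) ^ 2 ≤
      Real.log ‖discriminant τ‖ := by
  have h0 := qAbs_pos τ
  have hle := le_norm_discriminant τ
  rw [qParam_of_re_eq_neg_half h] at hle
  have h1 : ‖(1 : ℂ) - -(qAbs τ : ℂ)‖ = 1 + qAbs τ := by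
    rw [sub_neg_eq_add, ← Complex.ofReal_one, ← Complex.ofReal_add, Complex.norm_real,
      Real.norm_of_nonneg (by positivity)]
  rw [h1] at hle
  have h2 := Real.log_le_log (by positivity) hle
  rw [Real.log_mul (by positivity) (by positivity), Real.log_mul (by positivity) (by positivity),
    Real.log_pow, Real.log_exp] at h2
  have h3 : Real.log (qAbs τ) = -(2 * Real.pi * τ.im) := by rw [qAbs, Real.log_exp]
  have h4 := Real.one_sub_inv_le_log_of_pos (show 0 < 1 + qAbs τ by positivity)
  have h5 : 1 - (1 + qAbs τ)⁻¹ = qAbs τ / (1 + qAbs τ) := by field_simp; ring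
  rw [h5] at h4
  rw [h3] at h2
  push_cast at h2
  linarith

theorem log_norm_discriminant_le (τ : ℍ) :
    Real.log ‖discriminant τ‖ ≤ -(2 * Real.pi * τ.im) + 24 * (qAbs τ / (1 - qAbs τ)) := by
  rw [Real.log_le_iff_le_exp (norm_pos_iff.mpr (discriminant_ne_zero τ))]
  exact norm_discriminant_le τ

theorem ρ_re : (ρ : ℍ).re = -1 / 2 := rfl

theorem ρ_im : (ρ : ℍ).im = √3 / 2 := rfl

theorem div_one_sub_mono {x y : ℝ} (hxy : x ≤ y) (hy : y < 1) : x / (1 - x) ≤ y / (1 - y) := by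
  rw [div_le_div_iff₀ (by linarith) (by linarith)]
  nlinarith

theorem log_norm_discriminant_ρ_bounds :
    -5.3385 ≤ Real.log ‖discriminant ρ‖ ∧ Real.log ‖discriminant ρ‖ ≤ -5.3365 := by
  obtain ⟨h1, h2⟩ := pi_mul_sqrt_three_bounds
  obtain ⟨h3, h4⟩ := exp_neg_pi_mul_sqrt_three_bounds
  have h5 : 2 * Real.pi * (ρ : ℍ).im = Real.pi * √3 := by rw [ρ_im]; ring
  constructor
  · refine le_trans ?_ (le_log_norm_discriminant ρ_re)
    rw [h5, qAbs_ρ]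
    set t := Real.exp (-(Real.pi * √3))
    have h6 : t / (1 - t) ≤ 0.00434 / (1 - 0.00434) := div_one_sub_mono h4 (by norm_num)
    have h7 : 0.00433 / (1 + 0.00433) ≤ t / (1 + t) := by
      rw [div_le_div_iff₀ (by norm_num) (by linarith)]; nlinarith
    have h8 : (t / (1 - t)) ^ 2 ≤ (0.00434 / (1 - 0.00434)) ^ 2 := by
      gcongr
      exact div_nonneg (by linarith) (by linarith)
    norm_num at h7 h8
    linarith
  · refine (log_norm_discriminant_le ρ).trans ?_
    rw [h5, qAbs_ρ]
    set t := Real.exp (-(Real.pi * √3))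
    have h6 : t / (1 - t) ≤ 0.00434 / (1 - 0.00434) := div_one_sub_mono h4 (by norm_num)
    norm_num at h6
    linarith

theorem log_three_div_four_bounds : -0.2877 ≤ Real.log (3 / 4) ∧ Real.log (3 / 4) ≤ -0.2876 := by
  constructor
  · rw [Real.le_log_iff_exp_le (by norm_num)]
    exact exp_neg_le_of_le (by norm_num) (le_trans (by norm_num) (le_exp_of_le 0 0.071925
      (by norm_num) (by norm_num)))
  · rw [Real.log_le_iff_le_exp (by norm_num)]
    exact le_exp_neg_of_le (by norm_num) ((exp_le_of_le 0 0.0719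
      (by norm_num) (by norm_num) (by norm_num)).trans (by norm_num))

/-! ### Near-maximality of `y⁶|Δ|` at `ρ`, and the logarithm of `deltaHat`. -/

/-- The logarithm of the invariant function `y⁶ |Δ|`. -/
noncomputable def logPet (τ : ℍ) : ℝ := Real.log (τ.im ^ 6 * ‖discriminant τ‖)

theorem logPet_eq (τ : ℍ) : logPet τ = 6 * Real.log τ.im + Real.log ‖discriminant τ‖ := by
  rw [logPet, Real.log_mul (pow_ne_zero _ τ.im_ne_zero) (norm_ne_zero_iff.mpr
    (discriminant_ne_zero τ)), Real.log_pow]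
  norm_num

theorem gInfty_eq (τ : ℍ) : gInfty τ = -(6 * Real.log (4 * Real.pi)) - logPet τ := by
  have h1 : (4 * Real.pi) ^ 6 ≠ 0 := by positivity
  have h2 : τ.im ^ 6 * ‖discriminant τ‖ ≠ 0 := mul_ne_zero (pow_ne_zero _ τ.im_ne_zero)
    (norm_ne_zero_iff.mpr (discriminant_ne_zero τ))
  rw [gInfty, mul_pow, mul_assoc, Real.log_mul h1 h2, Real.log_pow, logPet]
  push_cast
  ring

theorem logPet_smul (γ : SL(2, ℤ)) (τ : ℍ) : logPet (γ • τ) = logPet τ := by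
  have := gInfty_smul γ τ
  rw [gInfty_eq, gInfty_eq] at this
  linarith

theorem sqrt_three_div_two_le_im {τ : ℍ} (h : τ ∈ ModularGroup.fd) : √3 / 2 ≤ τ.im := by
  have h1 := ModularGroup.three_le_four_mul_im_sq_of_mem_fd h
  have h2 : √3 ≤ 2 * τ.im := Real.sqrt_le_iff.mpr ⟨by have := τ.im_pos; positivity, by nlinarith⟩
  linarith

theorem qAbs_le_of_mem_fd {τ : ℍ} (h : τ ∈ ModularGroup.fd) : qAbs τ ≤ 0.00434 := by
  refine le_trans ?_ exp_neg_pi_mul_sqrt_three_bounds.2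
  rw [qAbs, Real.exp_le_exp]
  have := sqrt_three_div_two_le_im h
  have := Real.pi_pos
  nlinarith

theorem log_le_tangent {x a : ℝ} (hx : 0 < x) (ha : 0 < a) : Real.log x ≤ Real.log a + x / a - 1 := by
  have := Real.log_le_sub_one_of_pos (div_pos hx ha)
  rw [Real.log_div hx.ne' ha.ne'] at this
  linarith

/-- The invariant function `y⁶ |Δ|` is nearly maximal at `ρ`. -/
theorem logPet_le (τ : ℍ) : logPet τ ≤ 3 * Real.log (3 / 4) + Real.log ‖discriminant ρ‖ + 0.035 := by
  obtain ⟨γ, hγ⟩ := ModularGroup.exists_smul_mem_fd τ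
  rw [← logPet_smul γ, logPet_eq]
  set z := γ • τ
  have h1 := log_norm_discriminant_le z
  -- `0.955` is just above `3/π`, where `6 log y - 2πy` is maximal, so that the tangent slope
  -- `6/0.955` stays below `2π`.
  have h2 := log_le_tangent z.im_pos (a := 0.955) (by norm_num)
  have h3 : Real.log 0.955 ≤ -0.046 := by
    rw [Real.log_le_iff_le_exp (by norm_num)]
    exact le_exp_neg_of_le (by norm_num) ((exp_le_of_le 0 0.0115
      (by norm_num) (by norm_num) (by norm_num)).trans (by norm_num))
  have h4 := div_one_sub_mono (qAbs_le_of_mem_fd hγ) (by norm_num)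
  have h5 := log_three_div_four_bounds.1
  have h6 := log_norm_discriminant_ρ_bounds.1
  have h7 : 6 * (z.im / 0.955) ≤ 2 * Real.pi * z.im := by
    have := Real.pi_gt_d6
    have := z.im_pos
    rw [mul_div_assoc', div_le_iff₀ (by norm_num)]
    nlinarith
  norm_num at h4
  linarith

theorem discPoint_zero : discPoint 0 = ρ := by
  rw [discPoint]
  have : discTau 0 = ρ := by simp [discTau]
  rw [this, ofComplex_apply]

theorem deltaHat_zero : deltaHat 0 = discriminant ρ := by
  have h := deltaHat_pow (w := 0) (Metric.mem_ball_self one_pos)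
  rw [discDelta, discPoint_zero] at h
  simpa using h

theorem logPet_discPoint {w : ℂ} (hw : w ∈ Metric.ball (0 : ℂ) 1) :
    logPet (discPoint w) =
      3 * Real.log (3 / 4) + 6 * Real.log (1 - ‖w‖ ^ 2) + Real.log ‖deltaHat (w ^ 3)‖ := by
  have h1 : ‖deltaHat (w ^ 3)‖ ≠ 0 :=
    norm_ne_zero_iff.mpr (deltaHat_ne_zero (mem_ball_pow_three hw))
  have h2 : 0 < 1 - ‖w‖ ^ 2 := by
    have := mem_ball_zero_iff.mp hw
    nlinarith [norm_nonneg w]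
  rw [logPet, im_pow_six_mul_norm_discriminant hw, Real.log_mul (by norm_num) (by positivity),
    Real.log_mul (by positivity) h1, Real.log_pow,
    show (27 / 64 : ℝ) = (3 / 4) ^ 3 by norm_num, Real.log_pow]
  push_cast
  ring

theorem exists_deltaLog : ∃ H : ℂ → ℂ, DifferentiableOn ℂ H (Metric.ball 0 1) ∧ H 0 = 0 ∧
    (∀ z ∈ Metric.ball (0 : ℂ) 1, Complex.exp (H z) = deltaHat z / deltaHat 0) ∧
    ∀ z ∈ Metric.ball (0 : ℂ) 1, H (conj z) = conj (H z) := by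
  have h0 : (0 : ℂ) ∈ Metric.ball (0 : ℂ) 1 := Metric.mem_ball_self one_pos
  refine exists_log_on_ball one_pos (differentiableOn_deltaHat.div_const _)
    (div_self (deltaHat_ne_zero h0))
    (fun z hz => div_ne_zero (deltaHat_ne_zero hz) (deltaHat_ne_zero h0)) fun z hz => ?_
  have := deltaHat_conj h0
  rw [map_zero] at this
  rw [deltaHat_conj hz, map_div₀, ← this]

/-- The logarithm of `deltaHat`, normalized to vanish at the origin. -/
noncomputable def deltaLog : ℂ → ℂ := exists_deltaLog.choose

theorem differentiableOn_deltaLog : DifferentiableOn ℂ deltaLog (Metric.ball 0 1) :=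
  exists_deltaLog.choose_spec.1

theorem deltaLog_zero : deltaLog 0 = 0 := exists_deltaLog.choose_spec.2.1

theorem exp_deltaLog {s : ℂ} (hs : s ∈ Metric.ball (0 : ℂ) 1) :
    Complex.exp (deltaLog s) = deltaHat s / deltaHat 0 := exists_deltaLog.choose_spec.2.2.1 s hs

theorem deltaLog_conj {s : ℂ} (hs : s ∈ Metric.ball (0 : ℂ) 1) :
    deltaLog (conj s) = conj (deltaLog s) := exists_deltaLog.choose_spec.2.2.2 s hs

theorem log_norm_deltaHat {s : ℂ} (hs : s ∈ Metric.ball (0 : ℂ) 1) :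
    Real.log ‖deltaHat s‖ = Real.log ‖discriminant ρ‖ + (deltaLog s).re := by
  have h0 := deltaHat_ne_zero (s := 0) (Metric.mem_ball_self one_pos)
  have h1 := deltaHat_ne_zero hs
  have h := congrArg (fun z => Real.log ‖z‖) (exp_deltaLog hs)
  simp only [Complex.norm_exp, Real.log_exp, norm_div] at h
  rw [Real.log_div (norm_ne_zero_iff.mpr h1) (norm_ne_zero_iff.mpr h0), deltaHat_zero] at h
  linarith

/-- Near-maximality at `ρ` bounds the real part by `0.035 - 6 log(1 - |w|²)`, and `|s| < 8/27` means
`|w| < 2/3`. Such a one-sided bound is what Borel–Carathéodory requires. -/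
theorem re_deltaLog_le {s : ℂ} (hs : s ∈ Metric.ball (0 : ℂ) (8 / 27)) :
    (deltaLog s).re ≤ 3.57 := by
  have hs1 : s ∈ Metric.ball (0 : ℂ) 1 := Metric.ball_subset_ball (by norm_num) hs
  obtain ⟨w, hw, rfl⟩ := exists_pow_three_eq hs1
  have h1 := logPet_discPoint hw
  have h2 := logPet_le (discPoint w)
  rw [log_norm_deltaHat hs1] at h1
  have h3 : ‖w‖ < 2 / 3 := by
    rw [mem_ball_zero_iff, norm_pow] at hs
    refine lt_of_pow_lt_pow_left₀ 3 (by norm_num) (hs.trans_eq (by norm_num))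
  have h4 : Real.log (5 / 9) ≤ Real.log (1 - ‖w‖ ^ 2) :=
    Real.log_le_log (by norm_num) (by nlinarith [norm_nonneg w])
  have h5 : -0.588 ≤ Real.log (5 / 9) := by
    rw [Real.le_log_iff_exp_le (by norm_num)]
    exact exp_neg_le_of_le (by norm_num) (le_trans (by norm_num) (le_exp_of_le 0 0.147
      (by norm_num) (by norm_num)))
  linarith

theorem norm_deltaLog_le {s : ℂ} (hs : s ∈ Metric.ball (0 : ℂ) (1 / 8)) : ‖deltaLog s‖ ≤ 5.25 := by
  have h := Complex.borelCaratheodory_zero (f := deltaLog) (M := 3.57) (R := 8 / 27) (by norm_num)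
    (differentiableOn_deltaLog.mono (Metric.ball_subset_ball (by norm_num)))
    (fun z hz => re_deltaLog_le hz) (by norm_num)
    (Metric.ball_subset_ball (by norm_num) hs) deltaLog_zero
  refine h.trans ?_
  rw [mem_ball_zero_iff] at hs
  rw [div_le_iff₀ (by linarith)]
  linarith

theorem exists_deltaLog_taylor : ∃ c : ℕ → ℝ, c 0 = 0 ∧ (∀ m, |c m| ≤ 5.25 / (1 / 8) ^ m) ∧
    (∀ s ∈ Metric.ball (0 : ℂ) (1 / 8), HasSum (fun m => (c m : ℂ) * s ^ m) (deltaLog s)) ∧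
    ∀ s ∈ Metric.ball (0 : ℂ) (1 / 8),
      HasSum (fun m => (c m * m : ℂ) * s ^ m) (s * deriv deltaLog s) :=
  exists_real_taylor (by norm_num)
    (differentiableOn_deltaLog.mono (Metric.ball_subset_ball (by norm_num))) deltaLog_zero
    (fun _ hz => deltaLog_conj (Metric.ball_subset_ball (by norm_num) hz))
    fun _ hz => norm_deltaLog_le hz

/-- The Taylor coefficients of `deltaLog`. -/
noncomputable def deltaCoeff : ℕ → ℝ := exists_deltaLog_taylor.choose

theorem deltaCoeff_zero : deltaCoeff 0 = 0 := exists_deltaLog_taylor.choose_spec.1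

theorem abs_deltaCoeff_le (m : ℕ) : |deltaCoeff m| ≤ 5.25 / (1 / 8) ^ m :=
  exists_deltaLog_taylor.choose_spec.2.1 m

theorem hasSum_deltaLog {s : ℂ} (hs : s ∈ Metric.ball (0 : ℂ) (1 / 8)) :
    HasSum (fun m => (deltaCoeff m : ℂ) * s ^ m) (deltaLog s) :=
  exists_deltaLog_taylor.choose_spec.2.2.1 s hs

theorem hasSum_mul_deriv_deltaLog {s : ℂ} (hs : s ∈ Metric.ball (0 : ℂ) (1 / 8)) :
    HasSum (fun m => (deltaCoeff m * m : ℂ) * s ^ m) (s * deriv deltaLog s) :=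
  exists_deltaLog_taylor.choose_spec.2.2.2 s hs

theorem abs_re_sub_linear_le {R K : ℝ} {c : ℕ → ℝ} {f : ℂ → ℂ} {s : ℂ} (hR : 0 < R)
    (hs : ‖s‖ < R) (hc0 : c 0 = 0) (hc : ∀ m, |c m| ≤ K / R ^ m)
    (hsum : HasSum (fun m => (c m : ℂ) * s ^ m) (f s)) :
    |(f s).re - c 1 * s.re| ≤ K * (‖s‖ / R) ^ 2 / (1 - ‖s‖ / R) := by
  set x := ‖s‖ / R with hx
  have hx0 : 0 ≤ x := by positivity
  have hx1 : x < 1 := (div_lt_one hR).mpr hs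
  have h2 : HasSum (fun m => (c (m + 2) : ℂ) * s ^ (m + 2)) (f s - c 1 * s) := by
    have := (hasSum_nat_add_iff' 2).mpr hsum
    simpa [Finset.sum_range_succ, hc0] using this
  have hg := (hasSum_geometric_of_lt_one hx0 hx1).mul_left (K * x ^ 2)
  have hle : ∀ m, ‖(c (m + 2) : ℂ) * s ^ (m + 2)‖ ≤ K * x ^ 2 * x ^ m := by
    intro m
    rw [norm_mul, norm_pow, Complex.norm_real, Real.norm_eq_abs]
    calc _ ≤ K / R ^ (m + 2) * ‖s‖ ^ (m + 2) := by gcongr; exact hc _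
      _ = _ := by rw [hx, mul_assoc, ← pow_add, add_comm 2 m, div_pow]; ring
  have h4 := tsum_of_norm_bounded hg hle
  rw [h2.tsum_eq] at h4
  have h5 := (Complex.abs_re_le_norm _).trans h4
  rwa [Complex.sub_re, Complex.re_ofReal_mul, ← div_eq_mul_inv] at h5

theorem ofReal_mem_ball_one {x : ℝ} (hx : |x| < 1) : (x : ℂ) ∈ Metric.ball (0 : ℂ) 1 := by
  rwa [mem_ball_zero_iff, Complex.norm_real, Real.norm_eq_abs]

theorem norm_one_add_ofReal {x : ℝ} (hx : |x| < 1) : ‖(1 : ℂ) + x‖ = 1 + x := by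
  rw [← Complex.ofReal_one, ← Complex.ofReal_add, Complex.norm_real, Real.norm_of_nonneg]
  linarith [(abs_lt.mp hx).1]

theorem re_discPoint_ofReal {x : ℝ} (hx : |x| < 1) : (discPoint x).re = -1 / 2 := by
  have h1 := abs_lt.mp hx
  have h3 : (1 : ℝ) + x ≠ 0 := by linarith
  have h2 : discTau x = (((1 + x)⁻¹ : ℝ) : ℂ) * (ρ + conj (ρ : ℂ) * x) := by
    rw [discTau]; push_cast; rw [div_eq_inv_mul]
  rw [← coe_re, coe_discPoint (ofReal_mem_ball_one hx), h2, Complex.re_ofReal_mul]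
  simp only [Complex.add_re, Complex.mul_re, Complex.conj_re, Complex.ofReal_re,
    Complex.ofReal_im, coe_re, ρ_re]
  field_simp
  ring

theorem im_discPoint_ofReal {x : ℝ} (hx : |x| < 1) :
    (discPoint x).im = √3 / 2 * ((1 - x) / (1 + x)) := by
  have h1 := abs_lt.mp hx
  have h3 : (1 : ℝ) + x ≠ 0 := by linarith
  rw [im_discPoint (ofReal_mem_ball_one hx), norm_one_add_ofReal hx, Complex.norm_real,
    Real.norm_eq_abs, sq_abs]
  congr 1
  field_simp
  ring

theorem log_four_div_five_bounds :
    -0.22315 ≤ Real.log (4 / 5) ∧ Real.log (4 / 5) ≤ -0.22314 := by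
  constructor
  · rw [Real.le_log_iff_exp_le (by norm_num)]
    exact exp_neg_le_of_le (by norm_num) (le_trans (by norm_num) (le_exp_of_le 0 0.0557875
      (by norm_num) (by norm_num)))
  · rw [Real.log_le_iff_le_exp (by norm_num)]
    exact le_exp_neg_of_le (by norm_num) ((exp_le_of_le 0 0.055785
      (by norm_num) (by norm_num) (by norm_num)).trans (by norm_num))

theorem re_deltaLog_neg_bounds : -0.148 ≤ (deltaLog ((-1 / 5 : ℝ) ^ 3 : ℂ)).re ∧
    (deltaLog ((-1 / 5 : ℝ) ^ 3 : ℂ)).re ≤ -0.1388 := by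
  have hx : |(-1 / 5 : ℝ)| < 1 := by rw [abs_lt]; norm_num
  have hw := ofReal_mem_ball_one hx
  have h1 := log_norm_deltaHat (mem_ball_pow_three hw)
  rw [deltaHat_pow hw, discDelta, norm_div, norm_pow, norm_one_add_ofReal hx, Real.log_div
    (norm_ne_zero_iff.mpr (discriminant_ne_zero _)) (by norm_num), Real.log_pow,
    show (1 + -1 / 5 : ℝ) = 4 / 5 by norm_num] at h1
  have h2 := le_log_norm_discriminant (re_discPoint_ofReal hx)
  have h3 := log_norm_discriminant_le (discPoint (-1 / 5 : ℝ))
  obtain ⟨p1, p2⟩ := pi_mul_sqrt_three_bounds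
  have him : 2 * Real.pi * (discPoint (-1 / 5 : ℝ)).im = 3 / 2 * (Real.pi * √3) := by
    rw [im_discPoint_ofReal hx]; ring
  have hq : qAbs (discPoint (-1 / 5 : ℝ)) ≤ 0.000287 := by
    rw [qAbs, him]
    exact exp_neg_le_of_le (by norm_num) (le_trans (by norm_num) (le_exp_of_le 8 0.04
      (by norm_num; linarith) (by norm_num)))
  have hq0 := qAbs_pos (discPoint (-1 / 5 : ℝ))
  rw [him] at h2 h3
  set t := qAbs (discPoint (-1 / 5 : ℝ))
  have h6 : t / (1 - t) ≤ 0.000287 / (1 - 0.000287) := div_one_sub_mono hq (by norm_num)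
  have h7 : (t / (1 - t)) ^ 2 ≤ t / (1 + t) := by
    have : 0 < 1 - t := by linarith
    rw [div_pow, div_le_div_iff₀ (by positivity) (by positivity)]
    nlinarith
  obtain ⟨a1, a2⟩ := log_four_div_five_bounds
  obtain ⟨b1, b2⟩ := log_norm_discriminant_ρ_bounds
  norm_num at h6
  constructor <;> linarith

/-- The coefficient is read off from the value at `w = -1/5`, that is `s = -1/125`, where the
quadratic remainder is at most about `0.023`. -/
theorem deltaCoeff_one_bounds : 14 ≤ deltaCoeff 1 ∧ deltaCoeff 1 ≤ 21.5 := by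
  have hn : ‖((-1 / 5 : ℝ) ^ 3 : ℂ)‖ = 1 / 125 := by
    rw [norm_pow, Complex.norm_real]; norm_num
  have hre : ((-1 / 5 : ℝ) ^ 3 : ℂ).re = -1 / 125 := by
    rw [← Complex.ofReal_pow, Complex.ofReal_re]; norm_num
  have h := abs_re_sub_linear_le (f := deltaLog) (s := ((-1 / 5 : ℝ) ^ 3 : ℂ)) (R := 1 / 8)
    (by norm_num) (by rw [hn]; norm_num) deltaCoeff_zero abs_deltaCoeff_le
    (hasSum_deltaLog (by rw [mem_ball_zero_iff, hn]; norm_num))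
  obtain ⟨h1, h2⟩ := re_deltaLog_neg_bounds
  rw [hn, hre, abs_le] at h
  norm_num at h h1 h2 ⊢
  constructor <;> linarith [h.1, h.2]

/-! ### The size of `E₄` near `ρ`, and the logarithm of `eHat`. -/

theorem im_sq_mul_norm_E₄_smul (γ : SL(2, ℤ)) (τ : ℍ) :
    (γ • τ).im ^ 2 * ‖E₄ (γ • τ)‖ = τ.im ^ 2 * ‖E₄ τ‖ := by
  have h0 : denom γ τ ≠ 0 := denom_ne_zero _ _
  rw [E₄_smul, ModularGroup.im_smul_eq_div_normSq, Complex.normSq_eq_norm_sq, norm_mul, norm_pow]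
  have : ‖denom γ τ‖ ≠ 0 := norm_ne_zero_iff.mpr h0
  field_simp

/-- `|cρ + d|² = c² - cd + d²` is a positive integer. -/
theorem one_le_norm_denom_ρ (γ : SL(2, ℤ)) : 1 ≤ ‖denom γ ρ‖ := by
  have h0 : denom γ ρ ≠ 0 := denom_ne_zero _ _
  have h1 : Complex.normSq (denom γ ρ) =
      ((γ 1 0 ^ 2 - γ 1 0 * γ 1 1 + γ 1 1 ^ 2 : ℤ) : ℝ) := by
    rw [ModularGroup.denom_apply, Complex.normSq_apply]
    have h3 : √3 ^ 2 = 3 := Real.sq_sqrt (by norm_num)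
    simp [ρ]
    linear_combination (γ 1 0 : ℝ) ^ 2 / 4 * h3
  have h2 := Complex.normSq_pos.mpr h0
  rw [h1] at h2
  have h3 : (1 : ℤ) ≤ γ 1 0 ^ 2 - γ 1 0 * γ 1 1 + γ 1 1 ^ 2 := by exact_mod_cast h2
  have h4 : (1 : ℝ) ≤ ‖denom γ ρ‖ ^ 2 := by
    rw [← Complex.normSq_eq_norm_sq, h1]
    exact_mod_cast h3
  nlinarith [norm_nonneg (denom γ ρ)]

theorem denom_discPoint (γ : SL(2, ℤ)) {w : ℂ} (hw : w ∈ Metric.ball (0 : ℂ) 1) :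
    denom γ (discPoint w) = (denom γ ρ + conj (denom γ ρ) * w) / (1 + w) := by
  have h1 := one_add_ne_zero_of_mem_ball hw
  rw [ModularGroup.denom_apply, ModularGroup.denom_apply, coe_discPoint hw, discTau]
  simp only [map_add, map_mul, map_intCast]
  field_simp
  ring

/-- For `|w| < 1/2` this keeps the representative in the fundamental domain below height `3√3/2`;
the invariant `y²|E₄|` is unbounded at the cusp. -/
theorem im_smul_discPoint_le (γ : SL(2, ℤ)) {w : ℂ} (hw : w ∈ Metric.ball (0 : ℂ) 1) :
    (γ • discPoint w).im ≤ √3 / 2 * ((1 + ‖w‖) / (1 - ‖w‖)) := by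
  have hw1 := mem_ball_zero_iff.mp hw
  have h1 := one_add_ne_zero_of_mem_ball hw
  have h2 : 0 < ‖1 + w‖ := norm_pos_iff.mpr h1
  have h3 := one_le_norm_denom_ρ γ
  have h4 : 1 - ‖w‖ ≤ ‖denom γ ρ + conj (denom γ ρ) * w‖ := by
    have h5 := norm_sub_norm_le (denom γ ρ) (-(conj (denom γ ρ) * w))
    rw [norm_neg, norm_mul, Complex.norm_conj, sub_neg_eq_add] at h5
    nlinarith
  rw [ModularGroup.im_smul_eq_div_normSq, Complex.normSq_eq_norm_sq, denom_discPoint γ hw,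
    norm_div, im_discPoint hw, div_pow, mul_div_assoc, div_div_div_cancel_right₀ (by positivity)]
  refine mul_le_mul_of_nonneg_left ?_ (by positivity)
  rw [div_le_div_iff₀ (by nlinarith) (by linarith)]
  have h6 : (1 - ‖w‖) ^ 2 ≤ ‖denom γ ρ + conj (denom γ ρ) * w‖ ^ 2 := by
    gcongr
  nlinarith [norm_nonneg w]

theorem norm_E₄_le {τ : ℍ} {q : ℝ} (hq : qAbs τ ≤ q) (hq1 : 16 * q < 1) :
    ‖E₄ τ‖ ≤ 1 + 240 * (q / (1 - 16 * q)) := by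
  have h1 := norm_E₄_sub_one_le (τ := τ) (by linarith)
  have h2 : qAbs τ / (1 - 16 * qAbs τ) ≤ q / (1 - 16 * q) := by
    rw [div_le_div_iff₀ (by linarith) (by linarith)]
    nlinarith
  have h3 := norm_sub_norm_le (E₄ τ) 1
  rw [norm_one] at h3
  linarith

theorem qAbs_le_of_le_im {τ : ℍ} {y : ℝ} (h : y ≤ τ.im) : qAbs τ ≤ Real.exp (-(2 * Real.pi * y)) := by
  rw [qAbs, Real.exp_le_exp]
  have := Real.pi_pos
  nlinarith

theorem im_sq_mul_norm_E₄_le_of_mem_fd {τ : ℍ} (h : τ ∈ ModularGroup.fd)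
    (him : τ.im ≤ 3 * √3 / 2) : τ.im ^ 2 * ‖E₄ τ‖ ≤ 6.9 := by
  have hpos := τ.im_pos
  -- Below `1.8` the bound for `|q|` at `ρ` is good enough; above, `|q|` is negligible and `y² ≤
  -- 27/4`.
  rcases le_total τ.im 1.8 with hy | hy
  · have h1 := norm_E₄_le (qAbs_le_of_mem_fd h) (by norm_num)
    calc τ.im ^ 2 * ‖E₄ τ‖ ≤ 1.8 ^ 2 * (1 + 240 * (0.00434 / (1 - 16 * 0.00434))) := by gcongr
      _ ≤ _ := by norm_num
  · have h2 : qAbs τ ≤ 0.0000125 := by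
      refine (qAbs_le_of_le_im hy).trans ?_
      have := Real.pi_gt_d6
      exact exp_neg_le_of_le (by norm_num) (le_trans (by norm_num) (le_exp_of_le 11 0.0774
        (by norm_num; linarith) (by norm_num)))
    have h1 := norm_E₄_le h2 (by norm_num)
    have h3 : τ.im ^ 2 ≤ 27 / 4 := by
      have : √3 ^ 2 = 3 := Real.sq_sqrt (by norm_num)
      nlinarith
    calc τ.im ^ 2 * ‖E₄ τ‖ ≤ 27 / 4 * (1 + 240 * (0.0000125 / (1 - 16 * 0.0000125))) := by gcongr
      _ ≤ _ := by norm_num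

theorem norm_discE₄_le {w : ℂ} (hw : w ∈ Metric.ball (0 : ℂ) (1 / 2)) : ‖discE₄ w‖ ≤ 16.36 := by
  have hw1 : w ∈ Metric.ball (0 : ℂ) 1 := Metric.ball_subset_ball (by norm_num) hw
  have hn := mem_ball_zero_iff.mp hw
  obtain ⟨γ, hγ⟩ := ModularGroup.exists_smul_mem_fd (discPoint w)
  have h1 := im_smul_discPoint_le γ hw1
  have h2 : (1 + ‖w‖) / (1 - ‖w‖) ≤ 3 := by
    rw [div_le_iff₀ (by linarith)]
    linarith
  have h3 := im_sq_mul_norm_E₄_le_of_mem_fd hγ (by nlinarith [Real.sqrt_nonneg 3])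
  rw [im_sq_mul_norm_E₄_smul, im_sq_mul_norm_E₄ hw1] at h3
  have h4 : (9 / 16) ≤ (1 - ‖w‖ ^ 2) ^ 2 := by
    have : 3 / 4 ≤ 1 - ‖w‖ ^ 2 := by nlinarith [norm_nonneg w]
    nlinarith
  nlinarith [norm_nonneg (discE₄ w)]

/-- Schwarz lemma for `discE₄`, which vanishes at `0`, on the disc of radius `1/2`. -/
theorem norm_eHat_le {s : ℂ} (hs : s ∈ Metric.ball (0 : ℂ) (1 / 8)) : ‖eHat s‖ ≤ 32.72 := by
  have hs1 : s ∈ Metric.ball (0 : ℂ) 1 := Metric.ball_subset_ball (by norm_num) hs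
  obtain ⟨w, hw, rfl⟩ := exists_pow_three_eq hs1
  have h3 : ‖w‖ < 1 / 2 := by
    rw [mem_ball_zero_iff, norm_pow] at hs
    refine lt_of_pow_lt_pow_left₀ 3 (by norm_num) (hs.trans_eq (by norm_num))
  rw [eHat_pow hw]
  refine (Complex.norm_dslope_le_div_of_mapsTo_ball (R₁ := 1 / 2) (R₂ := 16.36)
    (differentiableOn_discE₄.mono (Metric.ball_subset_ball (by norm_num))) (fun z hz => ?_)
    (mem_ball_zero_iff.mpr h3)).trans_eq (by norm_num)
  rw [discE₄_zero, mem_closedBall_zero_iff]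
  exact norm_discE₄_le hz

theorem norm_eHat_sub_le {s : ℂ} (hs : s ∈ Metric.ball (0 : ℂ) (1 / 8)) :
    ‖eHat s - eHat 0‖ ≤ 523.6 * ‖s‖ := by
  have h := Complex.dist_le_div_mul_dist_of_mapsTo_ball (f := eHat) (R₁ := 1 / 8) (R₂ := 65.44)
    (differentiableOn_eHat.mono (Metric.ball_subset_ball (by norm_num))) (fun z hz => ?_) hs
  · rw [dist_eq_norm, dist_zero_right] at h
    refine h.trans ?_
    gcongr
    norm_num
  · rw [mem_closedBall_iff_norm]
    have h1 := norm_eHat_le hz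
    have h2 := norm_eHat_le (s := 0) (Metric.mem_ball_self (by norm_num))
    have := norm_sub_le (eHat z) (eHat 0)
    linarith

theorem im_eHat_zero : (eHat 0).im = 0 := by
  have := eHat_conj (s := 0) (Metric.mem_ball_self (by norm_num))
  rw [map_zero] at this
  exact Complex.conj_eq_iff_im.mp this.symm

/-- At `w = -1/10` the `q`-series of `E₄` gives `eHat (-1/1000)`; the Lipschitz bound carries it to
`0` at a cost of `0.5236`. -/
theorem re_eHat_zero_le : (eHat 0).re ≤ -9.85 := by
  have hx : |(-1 / 10 : ℝ)| < 1 := by rw [abs_lt]; norm_num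
  have hw := ofReal_mem_ball_one hx
  have h1 := mul_eHat_pow hw
  set z := discPoint ((-1 / 10 : ℝ) : ℂ) with hz
  have h2 : 2 * Real.pi * z.im = 11 / 9 * (Real.pi * √3) := by
    rw [hz, im_discPoint_ofReal hx]; ring
  obtain ⟨p1, p2⟩ := pi_mul_sqrt_three_bounds
  have hq : qAbs z ≤ 0.0013 := by
    rw [qAbs, h2]
    exact exp_neg_le_of_le (by norm_num) (le_trans (by norm_num) (le_exp_of_le 6 0.1625
      (by norm_num; linarith) (by norm_num)))
  have h3 := norm_E₄_sub_one_le (τ := z) (by linarith)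
  have h4 : qAbs z / (1 - 16 * qAbs z) ≤ 0.0013 / (1 - 16 * 0.0013) := by
    rw [div_le_div_iff₀ (by linarith) (by norm_num)]
    nlinarith
  have h5 := (Complex.abs_re_le_norm _).trans h3
  rw [Complex.sub_re, Complex.one_re, abs_le] at h5
  have h6 : eHat (((-1 / 10 : ℝ) : ℂ) ^ 3) = ((-100000 / 6561 : ℝ) : ℂ) * E₄ z := by
    rw [discE₄, ← hz] at h1
    push_cast at h1 ⊢
    norm_num at h1 ⊢
    linear_combination (-10) * h1
  have h7 := congrArg Complex.re h6
  rw [Complex.re_ofReal_mul] at h7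
  have hn : ‖((-1 / 10 : ℝ) : ℂ) ^ 3‖ = 1 / 1000 := by
    rw [norm_pow, Complex.norm_real]; norm_num
  have h8 := norm_eHat_sub_le (s := ((-1 / 10 : ℝ) : ℂ) ^ 3) (by
    rw [mem_ball_zero_iff, hn]; norm_num)
  rw [hn] at h8
  have h9 := (Complex.abs_re_le_norm _).trans h8
  rw [Complex.sub_re, abs_le, h7] at h9
  norm_num at h4 h9 ⊢
  linarith [h5.1, h9.1]

theorem eHat_zero_eq : eHat 0 = ((eHat 0).re : ℂ) := by
  apply Complex.ext <;> simp [im_eHat_zero]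

theorem deltaHat_zero_eq : deltaHat 0 = ((deltaHat 0).re : ℂ) := by
  have := deltaHat_conj (s := 0) (Metric.mem_ball_self (by norm_num))
  rw [map_zero] at this
  exact (Complex.conj_eq_iff_re.mp this.symm).symm

/-- `E₄(ρ) = 0` and `E₆(ρ)` is real, so `Δ(ρ) = -E₆(ρ)²/1728`. -/
theorem re_deltaHat_zero_neg : (deltaHat 0).re < 0 := by
  have h4 : E₄ ρ = 0 := by
    have := discE₄_zero
    rw [discE₄, discPoint_zero] at this
    simpa using this
  have hρ : ((ρ : ℍ) : ℂ) = -1 - conj ((ρ : ℍ) : ℂ) := by rw [conj_ρ]; ring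
  have h6 := (Complex.conj_eq_iff_re.mp (eisensteinSeries_conj (by norm_num : 3 ≤ 6) ⟨3, rfl⟩ hρ).symm)
  have h7 : deltaHat 0 = ((-((E₆ ρ).re ^ 2 / 1728) : ℝ) : ℂ) := by
    rw [deltaHat_zero, discriminant_eq_E₄_cube_sub_E₆_sq, h4]
    push_cast
    rw [h6]
    ring
  have h8 : deltaHat 0 ≠ 0 := deltaHat_ne_zero (Metric.mem_ball_self (by norm_num))
  rw [h7] at h8 ⊢
  rw [Complex.ofReal_re]
  rw [Complex.ofReal_ne_zero] at h8
  refine lt_of_le_of_ne ?_ h8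
  have := sq_nonneg (E₆ ρ).re
  linarith

theorem neg_re_deltaHat_zero_le : -(deltaHat 0).re ≤ 0.00482 := by
  have h1 : ‖discriminant ρ‖ ≤ 0.00482 := by
    rw [← Real.log_le_log_iff (norm_pos_iff.mpr (discriminant_ne_zero ρ)) (by norm_num)]
    refine log_norm_discriminant_ρ_bounds.2.trans ?_
    rw [Real.le_log_iff_exp_le (by norm_num)]
    exact exp_neg_le_of_le (by norm_num) (le_trans (by norm_num) (le_exp_of_le 5 0.0841
      (by norm_num) (by norm_num)))
  rw [← deltaHat_zero] at h1
  have := (neg_le_abs _).trans (Complex.abs_re_le_norm (deltaHat 0))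
  linarith

theorem eHat_zero_ne_zero : eHat 0 ≠ 0 := by
  rw [eHat_zero_eq, Complex.ofReal_ne_zero]
  have := re_eHat_zero_le
  linarith

/-- The logarithm of `eHat`, normalized to vanish at the origin. -/
noncomputable def eLog (s : ℂ) : ℂ := Complex.log (eHat s / eHat 0)

/-- Unlike `deltaHat`, `eHat` has zeros in the unit disc, at the other translates of `ρ`, so its
logarithm is only taken near `0`. The radius `1/110` makes `53.2/110 < 1/2`. -/
theorem norm_eHat_div_sub_one_le {s : ℂ} (hs : s ∈ Metric.ball (0 : ℂ) (1 / 110)) :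
    ‖eHat s / eHat 0 - 1‖ ≤ 53.2 * ‖s‖ := by
  have h1 := norm_eHat_sub_le (s := s) (Metric.ball_subset_ball (by norm_num) hs)
  have h2 : 9.85 ≤ ‖eHat 0‖ := by
    have := (neg_le_abs _).trans (Complex.abs_re_le_norm (eHat 0))
    have := re_eHat_zero_le
    linarith
  rw [div_sub_one eHat_zero_ne_zero, norm_div, div_le_iff₀ (by linarith)]
  nlinarith [norm_nonneg s]

theorem norm_eHat_div_sub_one_lt {s : ℂ} (hs : s ∈ Metric.ball (0 : ℂ) (1 / 110)) :
    ‖eHat s / eHat 0 - 1‖ < 1 / 2 := by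
  have h1 := norm_eHat_div_sub_one_le hs
  rw [mem_ball_zero_iff] at hs
  linarith

theorem eHat_div_mem_slitPlane {s : ℂ} (hs : s ∈ Metric.ball (0 : ℂ) (1 / 110)) :
    eHat s / eHat 0 ∈ Complex.slitPlane := by
  left
  have h1 := (Complex.abs_re_le_norm _).trans_lt (norm_eHat_div_sub_one_lt hs)
  rw [Complex.sub_re, Complex.one_re, abs_lt] at h1
  linarith [h1.1]

theorem eLog_zero : eLog 0 = 0 := by
  rw [eLog, div_self eHat_zero_ne_zero, Complex.log_one]

theorem exp_eLog {s : ℂ} (hs : s ∈ Metric.ball (0 : ℂ) (1 / 110)) :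
    Complex.exp (eLog s) = eHat s / eHat 0 :=
  Complex.exp_log (Complex.slitPlane_ne_zero (eHat_div_mem_slitPlane hs))

theorem differentiableOn_eLog : DifferentiableOn ℂ eLog (Metric.ball 0 (1 / 110)) :=
  ((differentiableOn_eHat.mono (Metric.ball_subset_ball (by norm_num))).div_const _).clog
    fun _ hs => eHat_div_mem_slitPlane hs

theorem eLog_conj {s : ℂ} (hs : s ∈ Metric.ball (0 : ℂ) (1 / 110)) :
    eLog (conj s) = conj (eLog s) := by
  have h0 : conj (eHat 0) = eHat 0 := by rw [eHat_zero_eq, Complex.conj_ofReal]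
  rw [eLog, eLog, eHat_conj (Metric.ball_subset_ball (by norm_num) hs),
    ← Complex.log_conj _ (Complex.slitPlane_arg_ne_pi (eHat_div_mem_slitPlane hs)), map_div₀, h0]

theorem norm_eLog_le {s : ℂ} (hs : s ∈ Metric.ball (0 : ℂ) (1 / 110)) :
    ‖eLog s‖ ≤ 79.8 * ‖s‖ := by
  have h1 := norm_eHat_div_sub_one_le hs
  have h := Complex.norm_log_one_add_half_le_self (norm_eHat_div_sub_one_lt hs).le
  rw [add_sub_cancel] at h
  refine h.trans ?_
  linarith

theorem exists_eLog_taylor : ∃ c : ℕ → ℝ, c 0 = 0 ∧ (∀ m, |c m| ≤ 0.75 / (1 / 110) ^ m) ∧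
    (∀ s ∈ Metric.ball (0 : ℂ) (1 / 110), HasSum (fun m => (c m : ℂ) * s ^ m) (eLog s)) ∧
    ∀ s ∈ Metric.ball (0 : ℂ) (1 / 110),
      HasSum (fun m => (c m * m : ℂ) * s ^ m) (s * deriv eLog s) :=
  exists_real_taylor (by norm_num) differentiableOn_eLog eLog_zero
    (fun _ hz => eLog_conj hz) fun z hz => by
      have h1 := norm_eLog_le hz
      rw [mem_ball_zero_iff] at hz
      linarith

/-- The Taylor coefficients of `eLog`. -/
noncomputable def eCoeff : ℕ → ℝ := exists_eLog_taylor.choose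

theorem eCoeff_zero : eCoeff 0 = 0 := exists_eLog_taylor.choose_spec.1

theorem abs_eCoeff_le (m : ℕ) : |eCoeff m| ≤ 0.75 / (1 / 110) ^ m :=
  exists_eLog_taylor.choose_spec.2.1 m

theorem hasSum_eLog {s : ℂ} (hs : s ∈ Metric.ball (0 : ℂ) (1 / 110)) :
    HasSum (fun m => (eCoeff m : ℂ) * s ^ m) (eLog s) :=
  exists_eLog_taylor.choose_spec.2.2.1 s hs

theorem hasSum_mul_deriv_eLog {s : ℂ} (hs : s ∈ Metric.ball (0 : ℂ) (1 / 110)) :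
    HasSum (fun m => (eCoeff m * m : ℂ) * s ^ m) (s * deriv eLog s) :=
  exists_eLog_taylor.choose_spec.2.2.2 s hs

/-! ### The normal form of `j` near `ρ`, and the point where `j = 1`. -/

/-- The derivative of `jHat` at the origin. -/
noncomputable def jScale : ℝ := (eHat 0).re ^ 3 / (deltaHat 0).re

theorem jScale_ge : 198000 ≤ jScale := by
  have h1 := re_eHat_zero_le
  have h2 := re_deltaHat_zero_neg
  have h3 := neg_re_deltaHat_zero_le
  have h4 : 9.85 ^ 3 ≤ (-(eHat 0).re) ^ 3 := by
    gcongr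
    linarith
  rw [jScale, ← neg_div_neg_eq, le_div_iff₀ (by linarith)]
  norm_num at h4
  nlinarith

theorem jHat_eq {s : ℂ} (hs : s ∈ Metric.ball (0 : ℂ) (1 / 110)) :
    jHat s = jScale * s * Complex.exp (3 * eLog s - deltaLog s) := by
  have hs1 : s ∈ Metric.ball (0 : ℂ) 1 := Metric.ball_subset_ball (by norm_num) hs
  have h0 := eHat_zero_ne_zero
  have h1 := deltaHat_ne_zero hs1
  have h2 : deltaHat 0 ≠ 0 := deltaHat_ne_zero (Metric.mem_ball_self (by norm_num))
  have h3 : (jScale : ℂ) = eHat 0 ^ 3 / deltaHat 0 := by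
    rw [jScale]
    push_cast
    rw [← eHat_zero_eq, ← deltaHat_zero_eq]
  rw [Complex.exp_sub, show (3 : ℂ) * eLog s = (3 : ℕ) * eLog s by norm_num, Complex.exp_nat_mul,
    exp_eLog hs, exp_deltaLog hs1, h3, jHat]
  field_simp

theorem eLog_ofReal {u : ℝ} (hu : |u| < 1 / 110) : eLog u = ((eLog u).re : ℂ) := by
  have := eLog_conj (s := u) (by rwa [mem_ball_zero_iff, Complex.norm_real])
  rw [Complex.conj_ofReal] at this
  exact (Complex.conj_eq_iff_re.mp this.symm).symm

theorem deltaLog_ofReal {u : ℝ} (hu : |u| < 1) : deltaLog u = ((deltaLog u).re : ℂ) := by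
  have := deltaLog_conj (s := u) (ofReal_mem_ball_one hu)
  rw [Complex.conj_ofReal] at this
  exact (Complex.conj_eq_iff_re.mp this.symm).symm

theorem jHat_ofReal {u : ℝ} (hu : |u| < 1 / 110) :
    jHat u = ((jScale * u * Real.exp (3 * (eLog u).re - (deltaLog u).re) : ℝ) : ℂ) := by
  rw [jHat_eq (by rwa [mem_ball_zero_iff, Complex.norm_real])]
  push_cast
  rw [← eLog_ofReal hu, ← deltaLog_ofReal (hu.trans (by norm_num))]

theorem norm_deltaLog_le_mul {s : ℂ} (hs : s ∈ Metric.ball (0 : ℂ) (1 / 110)) :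
    ‖deltaLog s‖ ≤ 26 * ‖s‖ := by
  have h := Complex.borelCaratheodory_zero (f := deltaLog) (M := 3.57) (R := 8 / 27) (by norm_num)
    (differentiableOn_deltaLog.mono (Metric.ball_subset_ball (by norm_num)))
    (fun z hz => re_deltaLog_le hz) (by norm_num)
    (Metric.ball_subset_ball (by norm_num) hs) deltaLog_zero
  refine h.trans ?_
  rw [mem_ball_zero_iff] at hs
  rw [div_le_iff₀ (by linarith)]
  nlinarith [norm_nonneg s]

theorem differentiableOn_jHat : DifferentiableOn ℂ jHat (Metric.ball 0 1) :=
  (differentiableOn_id.mul (differentiableOn_eHat.pow 3)).div differentiableOn_deltaHat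
    fun _ hs => deltaHat_ne_zero hs

/-- Intermediate value theorem on the real axis: `198000 · 0.0175³` exceeds `1` by six percent, and
the exponential factor is at least `0.998`. -/
theorem exists_jHat_pow_three_eq_one :
    ∃ r : ℝ, 0 < r ∧ r ≤ 0.0175 ∧ jHat ((r ^ 3 : ℝ) : ℂ) = 1 := by
  have hcont : ContinuousOn (fun r : ℝ => (jHat ((r ^ 3 : ℝ) : ℂ)).re) (Set.Icc 0 0.0175) := by
    refine Complex.continuous_re.comp_continuousOn (differentiableOn_jHat.continuousOn.comp
      (by fun_prop) fun r hr => ofReal_mem_ball_one ?_)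
    rw [abs_of_nonneg (pow_nonneg hr.1 3)]
    exact pow_lt_one₀ hr.1 (hr.2.trans_lt (by norm_num)) (by norm_num)
  have hsmall : ∀ r ∈ Set.Icc (0 : ℝ) 0.0175, |r ^ 3| ≤ 0.0175 ^ 3 := fun r hr => by
    rw [abs_of_nonneg (pow_nonneg hr.1 3)]
    exact pow_le_pow_left₀ hr.1 hr.2 3
  have h0 : (jHat (((0 : ℝ) ^ 3 : ℝ) : ℂ)).re = 0 := by simp [jHat]
  have h1 : 1 ≤ (jHat (((0.0175 : ℝ) ^ 3 : ℝ) : ℂ)).re := by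
    have hlt : |(0.0175 : ℝ) ^ 3| < 1 / 110 := by rw [abs_of_pos (by norm_num)]; norm_num
    have hb : (((0.0175 : ℝ) ^ 3 : ℝ) : ℂ) ∈ Metric.ball (0 : ℂ) (1 / 110) := by
      rwa [mem_ball_zero_iff, Complex.norm_real]
    rw [jHat_ofReal hlt, Complex.ofReal_re]
    have hn : ‖(((0.0175 : ℝ) ^ 3 : ℝ) : ℂ)‖ = 0.0175 ^ 3 := by
      rw [Complex.norm_real, Real.norm_of_nonneg (by norm_num)]
    have h2 := (Complex.abs_re_le_norm _).trans (norm_eLog_le hb)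
    have h3 := (Complex.abs_re_le_norm _).trans (norm_deltaLog_le_mul hb)
    rw [hn, abs_le] at h2 h3
    have h4 := Real.add_one_le_exp (3 * (eLog (((0.0175 : ℝ) ^ 3 : ℝ) : ℂ)).re -
      (deltaLog (((0.0175 : ℝ) ^ 3 : ℝ) : ℂ)).re)
    have h5 : 0.998 ≤ Real.exp (3 * (eLog (((0.0175 : ℝ) ^ 3 : ℝ) : ℂ)).re -
      (deltaLog (((0.0175 : ℝ) ^ 3 : ℝ) : ℂ)).re) := by
      refine le_trans ?_ h4
      have a := h2.1
      have b := h3.2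
      norm_num at a b ⊢
      linarith
    have hj : 0 ≤ jScale := le_trans (by norm_num) jScale_ge
    calc (1 : ℝ) ≤ 198000 * 0.0175 ^ 3 * 0.998 := by norm_num
      _ ≤ _ := by gcongr; exact jScale_ge
  obtain ⟨r, hr, h⟩ := intermediate_value_Icc (by norm_num) hcont
    (show (1 : ℝ) ∈ _ from ⟨h0.le.trans zero_le_one, h1⟩)
  refine ⟨r, lt_of_le_of_ne hr.1 ?_, hr.2, ?_⟩
  · rintro rfl
    simp only at h
    rw [h0] at h
    exact zero_ne_one h
  · simp only at h
    rw [jHat_ofReal ((hsmall r hr).trans_lt (by norm_num)), Complex.ofReal_re] at h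
    rw [jHat_ofReal ((hsmall r hr).trans_lt (by norm_num)), h, Complex.ofReal_one]

/-- The disc coordinate of the point near `ρ` where `j` takes the value `1`. -/
noncomputable def jRadius : ℝ := exists_jHat_pow_three_eq_one.choose

theorem jRadius_pos : 0 < jRadius := exists_jHat_pow_three_eq_one.choose_spec.1

theorem jRadius_le : jRadius ≤ 0.0175 := exists_jHat_pow_three_eq_one.choose_spec.2.1

theorem jHat_jRadius : jHat ((jRadius ^ 3 : ℝ) : ℂ) = 1 :=
  exists_jHat_pow_three_eq_one.choose_spec.2.2

/-! ### Explicit first-order estimates for `|w| ≤ 0.13`, and the size of the slope. -/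

theorem tail_factor_mono {x y : ℝ} (h0 : 0 ≤ x) (hxy : x ≤ y) (hy : y < 1) :
    4 * x / (1 - x) ^ 3 ≤ 4 * y / (1 - y) ^ 3 := by
  have : 0 < 1 - y := by linarith
  have : 0 ≤ y := h0.trans hxy
  gcongr

/-- `0.002197 = 0.13³` is the bound on `|s|`. Against the first coefficient, the tail leaves the
constants `10.8 ≤ 14 - 3.12` and `24.7 ≥ 21.5 + 3.12` used below. -/
theorem deltaLog_tail_factor_le {r : ℝ} (h0 : 0 ≤ r) (h : r ≤ 0.002197) :
    5.25 / (1 / 8) * (4 * (r / (1 / 8)) / (1 - r / (1 / 8)) ^ 3) ≤ 3.12 := by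
  have := tail_factor_mono (x := r / (1 / 8)) (y := 0.017576) (by positivity) (by linarith)
    (by norm_num)
  norm_num at this ⊢
  linarith

theorem eLog_tail_factor_le {r : ℝ} (h0 : 0 ≤ r) (h : r ≤ 0.002197) :
    0.75 / (1 / 110) * (4 * (r / (1 / 110)) / (1 - r / (1 / 110)) ^ 3) ≤ 183 := by
  have := tail_factor_mono (x := r / (1 / 110)) (y := 0.24167) (by positivity) (by linarith)
    (by norm_num)
  norm_num at this ⊢
  linarith

theorem abs_eCoeff_one_le : |eCoeff 1| ≤ 82.5 := (abs_eCoeff_le 1).trans (by norm_num)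

theorem le_re_deltaLog_norm_sub {s : ℂ} (hs : ‖s‖ ≤ 0.002197) :
    10.8 * (‖s‖ - s.re) ≤ (deltaLog (‖s‖ : ℝ)).re - (deltaLog s).re := by
  have h := abs_sub_re_sub_linear_le (K := 5.25) (by norm_num : (0 : ℝ) < 1 / 8) (by norm_num)
    (hs.trans_lt (by norm_num)) rfl deltaCoeff_zero abs_deltaCoeff_le fun _ => hasSum_deltaLog
  have h1 := deltaLog_tail_factor_le (norm_nonneg s) hs
  have h2 := Complex.re_le_norm s
  have h3 := mul_le_mul_of_nonneg_left h1 (sub_nonneg.mpr h2)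
  have h4 := (abs_le.mp h).1
  have h5 := mul_le_mul_of_nonneg_right deltaCoeff_one_bounds.1 (sub_nonneg.mpr h2)
  linarith

theorem le_re_eLog_norm_sub {s : ℂ} (hs : ‖s‖ ≤ 0.002197) :
    -265.5 * (‖s‖ - s.re) ≤ (eLog (‖s‖ : ℝ)).re - (eLog s).re := by
  have h := abs_sub_re_sub_linear_le (K := 0.75) (by norm_num : (0 : ℝ) < 1 / 110) (by norm_num)
    (hs.trans_lt (by norm_num)) rfl eCoeff_zero abs_eCoeff_le fun _ => hasSum_eLog
  have h1 := eLog_tail_factor_le (norm_nonneg s) hs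
  have h2 := Complex.re_le_norm s
  have h3 := mul_le_mul_of_nonneg_left h1 (sub_nonneg.mpr h2)
  have h4 := (abs_le.mp h).1
  have h5 := mul_le_mul_of_nonneg_right (abs_le.mp abs_eCoeff_one_le).1 (sub_nonneg.mpr h2)
  linarith

/-- The Euler derivative `u d/du` of `deltaLog` on the real axis. -/
noncomputable def eulerDelta (u : ℝ) : ℝ := (u * deriv deltaLog u).re

/-- The Euler derivative `u d/du` of `eLog` on the real axis. -/
noncomputable def eulerE (u : ℝ) : ℝ := (u * deriv eLog u).re

theorem eulerDelta_sub_bounds {a b : ℝ} (hb : 0 ≤ b) (hba : b ≤ a) (ha : a ≤ 0.002197) :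
    10.8 * (a - b) ≤ eulerDelta a - eulerDelta b ∧
      eulerDelta a - eulerDelta b ≤ 24.7 * (a - b) := by
  have h := abs_sub_eulerDeriv_sub_linear_le (K := 5.25) (a := a) (b := b) (f := deltaLog)
    (by norm_num : (0 : ℝ) < 1 / 8) (by norm_num) (ha.trans_lt (by norm_num))
    ⟨hb.trans hba, le_rfl⟩ ⟨hb, hba⟩ deltaCoeff_zero abs_deltaCoeff_le
    fun _ => hasSum_mul_deriv_deltaLog
  have h1 := deltaLog_tail_factor_le (hb.trans hba) ha
  have h2 : 0 ≤ a - b := by linarith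
  rw [abs_of_nonneg h2, abs_le] at h
  have h3 := mul_le_mul_of_nonneg_left h1 h2
  have h5 := mul_le_mul_of_nonneg_right deltaCoeff_one_bounds.1 h2
  have h6 := mul_le_mul_of_nonneg_right deltaCoeff_one_bounds.2 h2
  rw [eulerDelta, eulerDelta]
  constructor <;> linarith [h.1, h.2]

theorem abs_eulerE_sub_le {a b : ℝ} (hb : 0 ≤ b) (hba : b ≤ a) (ha : a ≤ 0.002197) :
    |eulerE a - eulerE b| ≤ 265.5 * (a - b) := by
  have h := abs_sub_eulerDeriv_sub_linear_le (K := 0.75) (a := a) (b := b) (f := eLog)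
    (by norm_num : (0 : ℝ) < 1 / 110) (by norm_num) (ha.trans_lt (by norm_num))
    ⟨hb.trans hba, le_rfl⟩ ⟨hb, hba⟩ eCoeff_zero abs_eCoeff_le
    fun _ => hasSum_mul_deriv_eLog
  have h1 := eLog_tail_factor_le (hb.trans hba) ha
  have h2 : 0 ≤ a - b := by linarith
  rw [abs_of_nonneg h2, abs_le] at h
  have h3 := mul_le_mul_of_nonneg_left h1 h2
  have h4 := abs_le.mp abs_eCoeff_one_le
  have h5 := mul_le_mul_of_nonneg_right h4.1 h2
  have h6 := mul_le_mul_of_nonneg_right h4.2 h2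
  rw [eulerE, eulerE, abs_le]
  constructor <;> linarith [h.1, h.2]

theorem hasStrictDerivAt_re_deltaLog {u : ℝ} (hu : |u| < 1) :
    HasStrictDerivAt (fun x : ℝ => (deltaLog x).re) (deriv deltaLog u).re u :=
  ((differentiableOn_deltaLog.analyticAt (Metric.isOpen_ball.mem_nhds
    (ofReal_mem_ball_one hu))).hasStrictDerivAt).real_of_complex

theorem hasStrictDerivAt_re_eLog {u : ℝ} (hu : |u| < 1 / 110) :
    HasStrictDerivAt (fun x : ℝ => (eLog x).re) (deriv eLog u).re u :=
  ((differentiableOn_eLog.analyticAt (Metric.isOpen_ball.mem_nhds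
    (by rwa [mem_ball_zero_iff, Complex.norm_real]))).hasStrictDerivAt).real_of_complex

theorem hasStrictDerivAt_re_deltaLog_cube {r : ℝ} (h : |r ^ 3| < 1) :
    HasStrictDerivAt (fun x : ℝ => (deltaLog (x ^ 3 : ℝ)).re) (3 * eulerDelta (r ^ 3) / r) r := by
  refine (HasStrictDerivAt.comp (h := fun x : ℝ => x ^ 3) r (hasStrictDerivAt_re_deltaLog h)
    (hasStrictDerivAt_pow 3 r)).congr_deriv ?_
  rw [eulerDelta, Complex.re_ofReal_mul]
  field_simp
  norm_num
  ring

theorem hasStrictDerivAt_re_eLog_cube {r : ℝ} (h : |r ^ 3| < 1 / 110) :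
    HasStrictDerivAt (fun x : ℝ => (eLog (x ^ 3 : ℝ)).re) (3 * eulerE (r ^ 3) / r) r := by
  refine (HasStrictDerivAt.comp (h := fun x : ℝ => x ^ 3) r (hasStrictDerivAt_re_eLog h)
    (hasStrictDerivAt_pow 3 r)).congr_deriv ?_
  rw [eulerE, Complex.re_ofReal_mul]
  field_simp
  norm_num
  ring

theorem eulerDelta_zero : eulerDelta 0 = 0 := by simp [eulerDelta]

theorem eulerE_zero : eulerE 0 = 0 := by simp [eulerE]

/-- The value of `∂ₓ g_hyp(1)`. -/
noncomputable def slopeAtOne : ℝ :=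
  (4 * (jRadius ^ 2 / (1 - jRadius ^ 2)) - eulerDelta (jRadius ^ 3)) /
    (1 + 3 * eulerE (jRadius ^ 3) - eulerDelta (jRadius ^ 3))

theorem jRadius_cube_le : jRadius ^ 3 ≤ 0.0000054 :=
  (pow_le_pow_left₀ jRadius_pos.le jRadius_le 3).trans (by norm_num)

theorem eulerDelta_jRadius_bounds : 0 ≤ eulerDelta (jRadius ^ 3) ∧
    eulerDelta (jRadius ^ 3) ≤ 24.7 * jRadius ^ 3 := by
  have h0 := pow_pos jRadius_pos 3
  have h := eulerDelta_sub_bounds le_rfl h0.le (jRadius_cube_le.trans (by norm_num))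
  rw [eulerDelta_zero] at h
  constructor <;> linarith [h.1, h.2]

theorem slopeAtOne_denom_ge :
    0.99 ≤ 1 + 3 * eulerE (jRadius ^ 3) - eulerDelta (jRadius ^ 3) := by
  have h0 := pow_pos jRadius_pos 3
  have h := abs_eulerE_sub_le le_rfl h0.le (jRadius_cube_le.trans (by norm_num))
  rw [eulerE_zero, sub_zero, abs_le] at h
  have h2 := eulerDelta_jRadius_bounds.2
  have := jRadius_cube_le
  linarith [h.1]

theorem slopeAtOne_pos : 0 < slopeAtOne := by
  refine div_pos ?_ (lt_of_lt_of_le (by norm_num) slopeAtOne_denom_ge)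
  have h0 := jRadius_pos
  have h1 := jRadius_le
  have h2 := eulerDelta_jRadius_bounds.2
  have h3 : jRadius ^ 2 ≤ jRadius ^ 2 / (1 - jRadius ^ 2) := by
    rw [le_div_iff₀ (by nlinarith)]
    nlinarith [sq_nonneg (jRadius ^ 2)]
  have h4 : jRadius ^ 3 ≤ 0.0175 * jRadius ^ 2 := by nlinarith [sq_nonneg jRadius]
  have h5 : 0 < jRadius ^ 2 := by positivity
  linarith

theorem slopeAtOne_le : slopeAtOne ≤ 0.00125 := by
  have h0 := jRadius_pos
  have h1 := jRadius_le
  have h2 := eulerDelta_jRadius_bounds.1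
  have h3 : jRadius ^ 2 / (1 - jRadius ^ 2) ≤ 0.00030635 := by
    rw [div_le_iff₀ (by nlinarith)]
    nlinarith
  have h4 := slopeAtOne_denom_ge
  rw [slopeAtOne, div_le_iff₀ (by linarith)]
  linarith

/-- This says that the radial profile is critical at `jRadius`. -/
theorem slopeAtOne_equation :
    4 * (jRadius ^ 2 / (1 - jRadius ^ 2)) - slopeAtOne -
      ((1 - slopeAtOne) * eulerDelta (jRadius ^ 3) + 3 * slopeAtOne * eulerE (jRadius ^ 3)) = 0 := by
  have h := slopeAtOne_denom_ge
  have h1 : slopeAtOne * (1 + 3 * eulerE (jRadius ^ 3) - eulerDelta (jRadius ^ 3)) =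
      4 * (jRadius ^ 2 / (1 - jRadius ^ 2)) - eulerDelta (jRadius ^ 3) :=
    div_mul_cancel₀ _ (by linarith)
  linarith

/-! ### The derivative of `g_hyp` at `1`. -/

/-- The value of `g_hyp ∘ j` in the disc coordinate. -/
theorem gInfty_discPoint {w : ℂ} (hw : w ∈ Metric.ball (0 : ℂ) 1) :
    gInfty (discPoint w) = gInfty ρ - 6 * Real.log (1 - ‖w‖ ^ 2) - (deltaLog (w ^ 3)).re := by
  have h0 := logPet_discPoint (w := 0) (Metric.mem_ball_self one_pos)
  rw [gInfty_eq, gInfty_eq, logPet_discPoint hw, log_norm_deltaHat (mem_ball_pow_three hw)]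
  rw [discPoint_zero, zero_pow (by norm_num), deltaHat_zero] at h0
  rw [h0]
  simp
  ring

theorem gHyp_jHat_cube {g : ℂ → ℝ} (hg : gInfty = g ∘ jInv) {w : ℂ}
    (hw : w ∈ Metric.ball (0 : ℂ) 1) :
    g (jHat (w ^ 3)) = gInfty ρ - 6 * Real.log (1 - ‖w‖ ^ 2) - (deltaLog (w ^ 3)).re := by
  rw [← jInv_discPoint hw, ← gInfty_discPoint hw, hg, Function.comp_apply]

/-- For real `r`, `φ(r) = jHat(r³)` is real with nonzero derivative at `jRadius`, so it has a local
inverse `ψ`, and `g` on the real line near `1` is an explicit function of `ψ`. The derivative is the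
ratio of the `r`-derivatives of `g ∘ φ` and `φ`. -/
theorem hasLineDerivAt_of_eq_comp_jInv {g : ℂ → ℝ} (hg : gInfty = g ∘ jInv) :
    HasLineDerivAt ℝ g slopeAtOne (1 : ℂ) (1 : ℂ) := by
  have h0 := jRadius_pos
  have hle := jRadius_le
  have hcube : |jRadius ^ 3| < 1 / 110 := by
    rw [abs_of_pos (by positivity)]
    exact jRadius_cube_le.trans_lt (by norm_num)
  have hH := hasStrictDerivAt_re_deltaLog_cube (hcube.trans (by norm_num))
  have hB := hasStrictDerivAt_re_eLog_cube hcube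
  set X := eulerDelta (jRadius ^ 3) with hX
  set Y := eulerE (jRadius ^ 3) with hY
  set φ : ℝ → ℝ := fun r => jScale * r ^ 3 *
    Real.exp (3 * (eLog (r ^ 3 : ℝ)).re - (deltaLog (r ^ 3 : ℝ)).re) with hφ
  have hval : ∀ r : ℝ, |r ^ 3| < 1 / 110 → jHat ((r ^ 3 : ℝ) : ℂ) = (φ r : ℂ) :=
    fun r hr => jHat_ofReal hr
  have hφ1 : φ jRadius = 1 := by
    have := (hval _ hcube).symm.trans jHat_jRadius
    exact_mod_cast this
  have hden : 1 + 3 * Y - X ≠ 0 := by linarith [slopeAtOne_denom_ge]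
  have hφ' : HasStrictDerivAt φ (3 * (1 + 3 * Y - X) / jRadius) jRadius := by
    -- Since `φ = 1` at this point, the derivative is the logarithmic derivative.
    refine (((hasStrictDerivAt_pow 3 jRadius).const_mul jScale).mul
      (((hB.const_mul 3).sub hH).exp)).congr_deriv ?_
    have : ∀ a E : ℝ, a * jRadius ^ 3 * E = 1 → a * (3 * jRadius ^ 2) * E +
        a * jRadius ^ 3 * (E * (3 * (3 * Y / jRadius) - 3 * X / jRadius)) =
        3 * (1 + 3 * Y - X) / jRadius := by
      intro a E h
      field_simp
      linear_combination (1 + 3 * Y - X) * h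
    refine Eq.trans ?_ (this jScale _ hφ1)
    norm_num
  have hne : 3 * (1 + 3 * Y - X) / jRadius ≠ 0 := by positivity
  set ψ := hφ'.localInverse φ _ _ hne
  have hψ : HasStrictDerivAt ψ (3 * (1 + 3 * Y - X) / jRadius)⁻¹ 1 := by
    have := hφ'.to_localInverse hne
    rwa [hφ1] at this
  have hψ1 : ψ 1 = jRadius := by
    rw [← hφ1]
    exact (hφ'.eventually_left_inverse hne).self_of_nhds
  have hright : ∀ᶠ t in 𝓝 (1 : ℝ), φ (ψ t) = t := by
    rw [← hφ1]
    exact hφ'.eventually_right_inverse hne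
  have hsmall : ∀ᶠ t in 𝓝 (1 : ℝ), |ψ t ^ 3| < 1 / 110 ∧ |ψ t| < 1 := by
    have hc := hψ.hasDerivAt.continuousAt
    refine Filter.Eventually.and ?_ ?_
    · exact ContinuousAt.eventually_lt (by fun_prop) continuousAt_const (by rwa [hψ1])
    · refine hc.abs.eventually_lt continuousAt_const ?_
      rw [hψ1, abs_of_pos h0]
      linarith
  have heq : (fun t : ℝ => g (t : ℂ)) =ᶠ[𝓝 1] fun t => gInfty ρ - 6 * Real.log (1 - ψ t ^ 2) -
      (deltaLog (ψ t ^ 3 : ℝ)).re := by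
    filter_upwards [hright, hsmall] with t h1 h2
    have h3 := gHyp_jHat_cube hg (ofReal_mem_ball_one h2.2)
    rw [← Complex.ofReal_pow, hval _ h2.1, h1, Complex.norm_real, Real.norm_eq_abs, sq_abs] at h3
    exact h3
  have hu : HasDerivAt (fun r : ℝ => gInfty ρ - 6 * Real.log (1 - r ^ 2) -
      (deltaLog (r ^ 3 : ℝ)).re)
      (3 * (4 * (jRadius ^ 2 / (1 - jRadius ^ 2)) - X) / jRadius) (ψ 1) := by
    rw [hψ1]
    have hpos : 1 - jRadius ^ 2 ≠ 0 := by nlinarith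
    refine (((((hasDerivAt_pow 2 jRadius).const_sub 1).log hpos).const_mul 6).const_sub
      (gInfty ρ)).sub hH.hasDerivAt |>.congr_deriv ?_
    field_simp
    ring
  have hmain : HasDerivAt (fun t : ℝ => g (t : ℂ)) slopeAtOne 1 := by
    refine ((hu.comp 1 hψ.hasDerivAt).congr_of_eventuallyEq heq).congr_deriv ?_
    rw [slopeAtOne, ← hX, ← hY]
    field_simp
  rw [HasLineDerivAt]
  have h2 : HasDerivAt (fun t : ℝ => 1 + t) 1 0 := (hasDerivAt_id 0).const_add 1
  have h3 := HasDerivAt.comp (0 : ℝ) (by simpa using hmain) h2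
  rw [mul_one] at h3
  refine h3.congr_of_eventuallyEq (Eventually.of_forall fun t => ?_)
  simp

/-! ### The strict minimum in the disc `|w| ≤ 0.13`. -/

/-- The restriction of `g₁ ∘ j` to the positive real axis of the disc, up to a constant. -/
noncomputable def radialProfile (r : ℝ) : ℝ :=
  -(6 * Real.log (1 - r ^ 2)) - 3 * slopeAtOne * Real.log r -
    ((1 - slopeAtOne) * (deltaLog (r ^ 3 : ℝ)).re + 3 * slopeAtOne * (eLog (r ^ 3 : ℝ)).re)

/-- A third of the Euler derivative of `radialProfile`. -/
noncomputable def radialSlope (r : ℝ) : ℝ :=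
  4 * (r ^ 2 / (1 - r ^ 2)) - slopeAtOne -
    ((1 - slopeAtOne) * eulerDelta (r ^ 3) + 3 * slopeAtOne * eulerE (r ^ 3))

theorem abs_cube_lt {r : ℝ} (h0 : 0 ≤ r) (h : r ≤ 0.13) : |r ^ 3| < 1 / 110 := by
  rw [abs_of_nonneg (by positivity)]
  exact (pow_le_pow_left₀ h0 h 3).trans_lt (by norm_num)

theorem hasDerivAt_radialProfile {r : ℝ} (h0 : 0 < r) (h : r ≤ 0.13) :
    HasDerivAt radialProfile (3 * radialSlope r / r) r := by
  have hc := abs_cube_lt h0.le h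
  have hH := (hasStrictDerivAt_re_deltaLog_cube (hc.trans (by norm_num))).hasDerivAt
  have hB := (hasStrictDerivAt_re_eLog_cube hc).hasDerivAt
  have hpos : 1 - r ^ 2 ≠ 0 := by nlinarith
  refine ((((((hasDerivAt_pow 2 r).const_sub 1).log hpos).const_mul 6).neg.sub
    ((Real.hasDerivAt_log h0.ne').const_mul (3 * slopeAtOne))).sub
    ((hH.const_mul (1 - slopeAtOne)).add (hB.const_mul (3 * slopeAtOne)))).congr_deriv ?_
  rw [radialSlope]
  field_simp
  ring

/-- The quadratic term grows by at least `4(a² - b²)`, the others by at most `25.7(a³ - b³) ≤ 25.7(a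
+ b)(a² - b²)`, and `25.7 · 0.1475 < 4`. Comparison with `jRadius ≤ 0.0175` is all that is needed,
whence `0.1475 = 0.13 + 0.0175`. -/
theorem radialSlope_lt {a b : ℝ} (hb : 0 ≤ b) (hba : b < a) (ha : a ≤ 0.13) (hs : a + b ≤ 0.1475) :
    radialSlope b < radialSlope a := by
  have hba3 : b ^ 3 ≤ a ^ 3 := pow_le_pow_left₀ hb hba.le 3
  have ha3 : a ^ 3 ≤ 0.002197 := (pow_le_pow_left₀ (hb.trans hba.le) ha 3).trans (by norm_num)
  have h1 := (eulerDelta_sub_bounds (pow_nonneg hb 3) hba3 ha3)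
  have h2 := (abs_le.mp (abs_eulerE_sub_le (pow_nonneg hb 3) hba3 ha3)).2
  have h3 := slopeAtOne_pos
  have h4 := slopeAtOne_le
  have h5 : a ^ 2 - b ^ 2 ≤ a ^ 2 / (1 - a ^ 2) - b ^ 2 / (1 - b ^ 2) := by
    have p : 0 < 1 - a ^ 2 := by nlinarith
    have q : 0 < 1 - b ^ 2 := by nlinarith
    rw [div_sub_div _ _ p.ne' q.ne', le_div_iff₀ (by positivity)]
    have : (1 - a ^ 2) * (1 - b ^ 2) ≤ 1 := by nlinarith
    have h6 : 0 ≤ a ^ 2 - b ^ 2 := by nlinarith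
    nlinarith
  have h6 : a ^ 3 - b ^ 3 ≤ 0.1475 * (a ^ 2 - b ^ 2) := by
    have e1 : a ^ 3 - b ^ 3 ≤ (a ^ 2 - b ^ 2) * (a + b) := by
      nlinarith [mul_nonneg (mul_nonneg (hb.trans hba.le) hb) (sub_nonneg.mpr hba.le)]
    have e2 : 0 ≤ a ^ 2 - b ^ 2 := by nlinarith
    nlinarith
  have h7 : 0 < a ^ 2 - b ^ 2 := by nlinarith
  have h8 : 0 ≤ a ^ 3 - b ^ 3 := by linarith
  have h9 : (1 - slopeAtOne) * (eulerDelta (a ^ 3) - eulerDelta (b ^ 3)) ≤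
      24.7 * (a ^ 3 - b ^ 3) := by nlinarith [h1.1, h1.2]
  have h10 : 3 * slopeAtOne * (eulerE (a ^ 3) - eulerE (b ^ 3)) ≤ 1 * (a ^ 3 - b ^ 3) := by
    nlinarith
  rw [radialSlope, radialSlope]
  linarith

theorem radialSlope_jRadius : radialSlope jRadius = 0 := slopeAtOne_equation

theorem radialProfile_jRadius_lt {r : ℝ} (h0 : 0 < r) (h : r ≤ 0.13) (hne : r ≠ jRadius) :
    radialProfile jRadius < radialProfile r := by
  have hp := jRadius_pos
  have hle := jRadius_le
  rcases hne.lt_or_gt with hlt | hlt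
  · have : StrictAntiOn radialProfile (Set.Icc r jRadius) := by
      refine strictAntiOn_of_deriv_neg (convex_Icc _ _) (fun x hx =>
        (hasDerivAt_radialProfile (h0.trans_le hx.1)
          (hx.2.trans (hle.trans (by norm_num)))).continuousAt.continuousWithinAt) fun x hx => ?_
      rw [interior_Icc] at hx
      have hx0 := h0.trans hx.1
      rw [(hasDerivAt_radialProfile hx0 (by linarith [hx.2])).deriv]
      have := radialSlope_lt hx0.le hx.2 (by linarith) (by linarith [hx.2])
      rw [radialSlope_jRadius] at this
      exact div_neg_of_neg_of_pos (by linarith) hx0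
    exact this ⟨le_rfl, hlt.le⟩ ⟨hlt.le, le_rfl⟩ hlt
  · have : StrictMonoOn radialProfile (Set.Icc jRadius r) := by
      refine strictMonoOn_of_deriv_pos (convex_Icc _ _) (fun x hx =>
        (hasDerivAt_radialProfile (hp.trans_le hx.1)
          (hx.2.trans h)).continuousAt.continuousWithinAt) fun x hx => ?_
      rw [interior_Icc] at hx
      have hx0 := hp.trans hx.1
      rw [(hasDerivAt_radialProfile hx0 (by linarith [hx.2])).deriv]
      have := radialSlope_lt hp.le hx.1 (by linarith [hx.2]) (by linarith [hx.2])
      rw [radialSlope_jRadius] at this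
      exact div_pos (by linarith) hx0
    exact this ⟨le_rfl, hlt.le⟩ ⟨hlt.le, le_rfl⟩ hlt

theorem log_norm_jHat {s : ℂ} (hs : s ∈ Metric.ball (0 : ℂ) (1 / 110)) (h0 : s ≠ 0) :
    Real.log ‖jHat s‖ = Real.log jScale + Real.log ‖s‖ + 3 * (eLog s).re - (deltaLog s).re := by
  have h1 : 0 < jScale := lt_of_lt_of_le (by norm_num) jScale_ge
  have h2 : 0 < ‖s‖ := norm_pos_iff.mpr h0
  rw [jHat_eq hs, norm_mul, norm_mul, Complex.norm_real, Real.norm_of_nonneg h1.le,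
    Complex.norm_exp, Real.log_mul (by positivity) (by positivity), Real.log_mul h1.ne' h2.ne',
    Real.log_exp]
  simp
  ring

theorem gOne_jHat_cube {g : ℂ → ℝ} (hg : gInfty = g ∘ jInv) {w : ℂ} (h0 : w ≠ 0)
    (h : ‖w‖ ≤ 0.13) :
    gOne g (jHat (w ^ 3)) = gInfty ρ - slopeAtOne * Real.log jScale + radialProfile ‖w‖ +
      ((1 - slopeAtOne) * ((deltaLog (‖w ^ 3‖ : ℝ)).re - (deltaLog (w ^ 3)).re) +
        3 * slopeAtOne * ((eLog (‖w ^ 3‖ : ℝ)).re - (eLog (w ^ 3)).re)) := by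
  have hw : w ∈ Metric.ball (0 : ℂ) 1 := by rw [mem_ball_zero_iff]; linarith
  have hc : w ^ 3 ∈ Metric.ball (0 : ℂ) (1 / 110) := by
    rw [mem_ball_zero_iff, norm_pow]
    exact (le_abs_self _).trans_lt (abs_cube_lt (norm_nonneg w) h)
  rw [gOne, (hasLineDerivAt_of_eq_comp_jInv hg).lineDeriv, gHyp_jHat_cube hg hw,
    log_norm_jHat hc (pow_ne_zero 3 h0), norm_pow, Real.log_pow, radialProfile]
  push_cast
  ring

/-- `10.8(1 - κ) - 3κ · 265.5 > 9` for `κ ≤ 0.00125`. -/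
theorem angular_defect_nonneg {s : ℂ} (hs : ‖s‖ ≤ 0.002197) :
    9 * (‖s‖ - s.re) ≤ (1 - slopeAtOne) * ((deltaLog (‖s‖ : ℝ)).re - (deltaLog s).re) +
        3 * slopeAtOne * ((eLog (‖s‖ : ℝ)).re - (eLog s).re) := by
  have h1 := le_re_deltaLog_norm_sub hs
  have h2 := le_re_eLog_norm_sub hs
  have h3 := slopeAtOne_pos
  have h4 := slopeAtOne_le
  have h5 : 0 ≤ ‖s‖ - s.re := sub_nonneg.mpr (Complex.re_le_norm s)
  have h6 : (1 - slopeAtOne) * (10.8 * (‖s‖ - s.re)) ≤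
      (1 - slopeAtOne) * ((deltaLog (‖s‖ : ℝ)).re - (deltaLog s).re) :=
    mul_le_mul_of_nonneg_left h1 (by linarith)
  have h7 : 3 * slopeAtOne * (-265.5 * (‖s‖ - s.re)) ≤
      3 * slopeAtOne * ((eLog (‖s‖ : ℝ)).re - (eLog s).re) :=
    mul_le_mul_of_nonneg_left h2 (by linarith)
  have h8 : slopeAtOne * (‖s‖ - s.re) ≤ 0.00125 * (‖s‖ - s.re) :=
    mul_le_mul_of_nonneg_right h4 h5
  linarith

theorem gOne_one {g : ℂ → ℝ} (hg : gInfty = g ∘ jInv) :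
    gOne g 1 = gInfty ρ - slopeAtOne * Real.log jScale + radialProfile jRadius := by
  have h0 := jRadius_pos
  have hn : ‖(jRadius : ℂ)‖ = jRadius := by rw [Complex.norm_real, Real.norm_of_nonneg h0.le]
  have h := gOne_jHat_cube hg (w := (jRadius : ℂ)) (by exact_mod_cast h0.ne')
    (by rw [hn]; exact jRadius_le.trans (by norm_num))
  rw [norm_pow, hn, ← Complex.ofReal_pow, jHat_jRadius] at h
  rw [h]
  ring

theorem gOne_one_lt_of_norm_le {g : ℂ → ℝ} (hg : gInfty = g ∘ jInv) {w : ℂ} (h0 : w ≠ 0)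
    (h : ‖w‖ ≤ 0.13) (hne : jHat (w ^ 3) ≠ 1) : gOne g 1 < gOne g (jHat (w ^ 3)) := by
  rw [gOne_one hg, gOne_jHat_cube hg h0 h]
  have hs : ‖w ^ 3‖ ≤ 0.002197 := by
    rw [norm_pow]
    exact (pow_le_pow_left₀ (norm_nonneg w) h 3).trans (by norm_num)
  have h1 := angular_defect_nonneg hs
  have h2 := Complex.re_le_norm (w ^ 3)
  rcases eq_or_ne ‖w‖ jRadius with hr | hr
  -- On the circle of radius `jRadius` the radial parts agree, and strictness comes from the angular
  -- defect, which vanishes only where `w³` is the positive real with `j = 1`.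
  · have h3 : (w ^ 3).re ≠ ‖w ^ 3‖ := by
      intro he
      apply hne
      have h4 : w ^ 3 = ((jRadius ^ 3 : ℝ) : ℂ) := by
        have h5 := Complex.re_eq_norm.mp he
        rw [← hr, ← norm_pow, ← he]
        apply Complex.ext
        · simp
        · simpa using (Complex.nonneg_iff.mp h5).2.symm
      rw [h4, jHat_jRadius]
    have h4 := lt_of_le_of_ne h2 h3
    rw [hr]
    linarith
  · have h3 := radialProfile_jRadius_lt (norm_pos_iff.mpr h0) h hr
    linarith

/-! ### The region `Im τ ≥ 0.957`. -/

theorem E₄_ne_zero_of_jInv_ne_zero {τ : ℍ} (h : jInv τ ≠ 0) : E₄ τ ≠ 0 := by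
  contrapose! h
  simp [jInv, h]

theorem log_norm_jInv {τ : ℍ} (h : jInv τ ≠ 0) :
    Real.log ‖jInv τ‖ = 3 * Real.log ‖E₄ τ‖ - Real.log ‖discriminant τ‖ := by
  rw [jInv, norm_div, norm_pow, Real.log_div
    (pow_ne_zero 3 (norm_ne_zero_iff.mpr (E₄_ne_zero_of_jInv_ne_zero h)))
    (norm_ne_zero_iff.mpr (discriminant_ne_zero τ)), Real.log_pow]
  norm_num

theorem logPet_ρ : logPet ρ = 3 * Real.log (3 / 4) + Real.log ‖discriminant ρ‖ := by
  have h := logPet_discPoint (w := 0) (Metric.mem_ball_self one_pos)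
  rw [discPoint_zero, zero_pow (by norm_num), deltaHat_zero] at h
  rw [h]
  simp

theorem gOne_one_le {g : ℂ → ℝ} (hg : gInfty = g ∘ jInv) :
    gOne g 1 ≤ -(6 * Real.log (4 * Real.pi)) + 6.2037 := by
  have h0 := jRadius_pos
  have h1 := jRadius_le
  have h3 := jRadius_cube_le
  have hlt : |jRadius| < 1 := by rw [abs_of_pos h0]; linarith
  have h := gHyp_jHat_cube hg (ofReal_mem_ball_one hlt)
  rw [← Complex.ofReal_pow, jHat_jRadius, Complex.norm_real, Real.norm_of_nonneg h0.le] at h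
  rw [gOne, norm_one, Real.log_one, mul_zero, sub_zero, h, gInfty_eq, logPet_ρ]
  have hn : ‖((jRadius ^ 3 : ℝ) : ℂ)‖ = jRadius ^ 3 := by
    rw [Complex.norm_real, Real.norm_of_nonneg (by positivity)]
  have h4 := (Complex.abs_re_le_norm _).trans (norm_deltaLog_le_mul
    (s := ((jRadius ^ 3 : ℝ) : ℂ)) (by rw [mem_ball_zero_iff, hn]; linarith))
  rw [hn, abs_le] at h4
  have h5 := Real.one_sub_inv_le_log_of_pos (show 0 < 1 - jRadius ^ 2 by nlinarith)
  have h6 : (1 - jRadius ^ 2)⁻¹ ≤ 1.0003065 := by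
    rw [inv_le_comm₀ (by nlinarith) (by norm_num)]
    norm_num
    nlinarith
  have h7 := log_three_div_four_bounds.1
  have h8 := log_norm_discriminant_ρ_bounds.1
  linarith [h4.1]

theorem gOne_one_lt_of_le_im {g : ℂ → ℝ} (hg : gInfty = g ∘ jInv) {τ : ℍ} (hy : 0.957 ≤ τ.im)
    (hj : jInv τ ≠ 0) : gOne g 1 < gOne g (jInv τ) := by
  refine (gOne_one_le hg).trans_lt ?_
  have hgτ : g (jInv τ) = gInfty τ := by rw [hg]; rfl
  rw [gOne, (hasLineDerivAt_of_eq_comp_jInv hg).lineDeriv, hgτ, gInfty_eq, log_norm_jInv hj,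
    logPet_eq]
  have hκ := slopeAtOne_pos
  have hκ' := slopeAtOne_le
  have hπ := Real.pi_gt_d6
  have hq : qAbs τ ≤ 0.00246 := by
    refine (qAbs_le_of_le_im hy).trans (exp_neg_le_of_le (by norm_num) (le_trans (by norm_num)
      (le_exp_of_le 6 0.003 (by norm_num; linarith) (by norm_num))))
  have h1 : Real.log ‖E₄ τ‖ ≤ 0.62 := by
    have h2 := norm_E₄_le hq (by norm_num)
    have h3 := Real.log_le_sub_one_of_pos (norm_pos_iff.mpr (E₄_ne_zero_of_jInv_ne_zero hj))
    norm_num at h2 ⊢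
    linarith
  have h2 := log_norm_discriminant_le τ
  have h3 : qAbs τ / (1 - qAbs τ) ≤ 0.00246 / (1 - 0.00246) := div_one_sub_mono hq (by norm_num)
  -- The tangent is taken at the lowest height: its slope `6/0.957` is below `6.2753 ≤ 2π(1 - κ)`,
  -- so the resulting linear bound increases with `Im τ` and is least at `0.957`.
  have h4 := log_le_tangent τ.im_pos (a := 0.957) (by norm_num)
  have h5 : Real.log 0.957 ≤ -0.0439 := by
    rw [Real.log_le_iff_le_exp (by norm_num)]
    exact le_exp_neg_of_le (by norm_num) ((exp_le_of_le 0 0.010975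
      (by norm_num) (by norm_num) (by norm_num)).trans (by norm_num))
  have h6 : (1 - slopeAtOne) * Real.log ‖discriminant τ‖ ≤
      (1 - slopeAtOne) * (-(2 * Real.pi * τ.im) + 0.0592) := by
    refine mul_le_mul_of_nonneg_left ?_ (by linarith)
    norm_num at h3
    linarith
  have h7 : 3 * slopeAtOne * Real.log ‖E₄ τ‖ ≤ 3 * slopeAtOne * 0.62 :=
    mul_le_mul_of_nonneg_left h1 (by linarith)
  have h8 : 6.2753 * τ.im ≤ (1 - slopeAtOne) * (2 * Real.pi * τ.im) := by
    have h9 : 6.2753 ≤ (1 - slopeAtOne) * (2 * Real.pi) := by nlinarith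
    have := mul_le_mul_of_nonneg_right h9 τ.im_pos.le
    linarith
  have h9 : τ.im / 0.957 ≤ 1.0449321 * τ.im := by
    rw [div_le_iff₀ (by norm_num)]
    linarith
  linarith

/-! ### Covering the low part of the fundamental domain, and conclusion. -/

theorem norm_discCoord_le_of_bounds {τ : ℍ} {u : ℝ} (hu : (τ.re + 1 / 2) ^ 2 = u ^ 2) (h0 : 0 ≤ u)
    (h1 : u ≤ 1 / 2) (h2 : 1 ≤ (1 / 2 - u) ^ 2 + τ.im ^ 2) (h3 : √3 / 2 ≤ τ.im)
    (h4 : τ.im ≤ 0.957) : ‖discCoord τ‖ ≤ 0.13 := by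
  obtain ⟨p1, p2⟩ := sqrt_three_bounds
  have p3 : √3 ^ 2 = 3 := Real.sq_sqrt (by norm_num)
  -- Lying outside the unit circle below height `0.957` forces `1/2 - u ≥ 0.29`.
  have h5 : u ≤ 0.21 := by nlinarith
  have h6 : ‖(ρ : ℂ) - τ‖ ^ 2 = u ^ 2 + (τ.im - √3 / 2) ^ 2 := by
    rw [← hu, ← Complex.normSq_eq_norm_sq, Complex.normSq_apply]
    simp [ρ_re, ρ_im]
    ring
  have h7 : ‖(τ : ℂ) - conj (ρ : ℂ)‖ ^ 2 = u ^ 2 + (τ.im + √3 / 2) ^ 2 := by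
    rw [← hu, ← Complex.normSq_eq_norm_sq, Complex.normSq_apply]
    simp [ρ_re, ρ_im]
    ring
  have h8 : 0 < ‖(τ : ℂ) - conj (ρ : ℂ)‖ := norm_pos_iff.mpr (sub_conj_ρ_ne_zero τ)
  rw [discCoord, norm_div, div_le_iff₀ h8]
  refine (sq_le_sq₀ (norm_nonneg _) (by positivity)).mp ?_
  rw [mul_pow, h6, h7]
  have h9 : u ^ 2 ≤ 0.0441 := by nlinarith
  have h10 : τ.im ^ 2 ≤ (√3 / 2 + 0.957) * τ.im - 0.957 * (√3 / 2) := by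
    linarith [mul_nonneg (sub_nonneg.mpr h3) (sub_nonneg.mpr h4)]
  have h11 : 1.73205 * τ.im ≤ √3 * τ.im := mul_le_mul_of_nonneg_right p1.le τ.im_pos.le
  ring_nf at h10 h11 ⊢
  linarith

theorem exists_eq_jHat_cube_of_mem_fd {τ : ℍ} (h : τ ∈ ModularGroup.fd) (hy : τ.im ≤ 0.957) :
    ∃ w : ℂ, ‖w‖ ≤ 0.13 ∧ jHat (w ^ 3) = jInv τ := by
  have key : ∀ z : ℍ, jHat (discCoord z ^ 3) = jInv z := fun z => by
    rw [← jInv_discPoint (discCoord_mem_ball z), discPoint_discCoord]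
  have him := sqrt_three_div_two_le_im h
  have h1 : 1 ≤ τ.re ^ 2 + τ.im ^ 2 := by
    have := h.1
    rw [Complex.normSq_apply] at this
    simp only [coe_re, coe_im] at this
    nlinarith
  have h2 := abs_le.mp h.2
  rcases le_total τ.re 0 with hre | hre
  · refine ⟨discCoord τ, norm_discCoord_le_of_bounds (u := τ.re + 1 / 2) rfl (by linarith [h2.1])
      (by linarith) ?_ him hy, key τ⟩
    linarith
  -- In the right half the nearby corner is `ρ + 1`, which `T⁻¹` moves to `ρ`.
  · refine ⟨discCoord (ModularGroup.T⁻¹ • τ), norm_discCoord_le_of_bounds (u := 1 / 2 - τ.re) ?_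
      (by linarith [h2.2]) (by linarith) ?_ ?_ ?_, (key _).trans (jInv_smul _ _)⟩
    · rw [ModularGroup.re_T_inv_smul]; ring
    · rw [ModularGroup.im_T_inv_smul]; linarith
    · rwa [ModularGroup.im_T_inv_smul]
    · rwa [ModularGroup.im_T_inv_smul]

theorem gOne_one_lt {g : ℂ → ℝ} (hg : gInfty = g ∘ jInv) {ζ : ℂ} (h0 : ζ ≠ 0) (h1 : ζ ≠ 1) :
    gOne g 1 < gOne g ζ := by
  obtain ⟨τ, rfl⟩ := jInv_surjective ζ
  obtain ⟨γ, hγ⟩ := ModularGroup.exists_smul_mem_fd τ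
  rw [← jInv_smul γ] at h0 h1 ⊢
  rcases le_total 0.957 (γ • τ).im with hy | hy
  · exact gOne_one_lt_of_le_im hg hy h0
  · obtain ⟨w, hw, he⟩ := exists_eq_jHat_cube_of_mem_fd hγ hy
    rw [← he] at h0 h1 ⊢
    refine gOne_one_lt_of_norm_le hg ?_ hw h1
    rintro rfl
    simp [jHat] at h0

theorem propositionA :
    (∃! g : ℂ → ℝ, gInfty = g ∘ jInv) ∧
    ∀ gHyp : ℂ → ℝ, gInfty = gHyp ∘ jInv →
      LineDifferentiableAt ℝ gHyp (1 : ℂ) (1 : ℂ) ∧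
      0 < lineDeriv ℝ gHyp (1 : ℂ) (1 : ℂ) ∧ lineDeriv ℝ gHyp (1 : ℂ) (1 : ℂ) < 1 ∧
      ∀ ζ : ℂ, ζ ≠ 0 → (IsMinOn (gOne gHyp) {z : ℂ | z ≠ 0} ζ ↔ ζ = 1) := by
  refine ⟨existsUnique_gInfty_eq_comp_jInv, fun g hg => ?_⟩
  have hd := hasLineDerivAt_of_eq_comp_jInv hg
  refine ⟨hd.lineDifferentiableAt, by rw [hd.lineDeriv]; exact slopeAtOne_pos, ?_,
    fun ζ hζ => ⟨fun hmin => ?_, ?_⟩⟩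
  · rw [hd.lineDeriv]
    exact slopeAtOne_le.trans_lt (by norm_num)
  · by_contra h1
    exact (gOne_one_lt hg hζ h1).not_ge (hmin one_ne_zero)
  · rintro rfl z hz
    rcases eq_or_ne z 1 with rfl | h1
    · exact le_refl (gOne g 1)
    · exact (gOne_one_lt hg hz h1).le
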